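/- Let $p$ be a prime, $N\in\mathbb N$, and let $w=a_1a_2a_3\ldots$ be an infinite word over the alphabet $\mathcal A_N=\{1,\dots,N\}$. Let $P(w,n)$ be the number of distinct blocks of length $n$ occurring in $w$. For $a\in\mathbb N$ put $A_a=\begin{pmatrix}0&1\\1&a\end{pmatrix}$, acting on $\mathbf P^1(\mathbb Q_p)$, and let $\mathrm T(w,\mathbf q)=(a_2a_3\ldots,\,A_{a_1}\mathbf q)$ for $\mathbf q\in\mathbf P^1(\mathbb Q_p)$. For $\epsilon>0$ let $\mathbf{PBad}_\epsilon$ be the set of points $\mathbf q=(q_1:q_2)\in\mathbf P^1(\mathbb Q_p)$ such that $$\frac{|aq_1+bq_2|_p}{\max\{|q_1|_p,|q_2|_p\}}\ \ge\ \frac{\epsilon}{\max\{a^2,b^2\}}\qquad\text{for all }(a,b)\in\mathbb Z^2\setminus\{(0,0)\}.$$ Let $\mathbf{LMad}$ be the set of pairs $(v,\mathbf q)$, with $v$ an infinite word of positive integers and $\mathbf q\in\mathbf P^1(\mathbb Q_p)$, for which there is $\epsilon>0$ such that $\mathrm T^n(v,\mathbf q)\in\mathcal A_{\lfloor 1/\epsilon\rfloor+1}^{\mathbb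 N}\times\mathbf{PBad}_\epsilon$ for all $n\ge 0$. **Theorem.** Suppose that $w$ is not eventually periodic and that there is a constant $C>0$ with $P(w,n)\le n+C$ for all $n\ge1$. Then $(w,\mathbf x_p)\notin\mathbf{LMad}$ for every $\mathbf x_p\in\mathbf P^1(\mathbb Q_p)$. In particular, this holds for every Sturmian word $w$ over $\mathcal A_N$, i.e. every $w$ with $P(w,n)=n+1$ for all $n\ge 0$. -/

import Mathlib

open scoped LinearAlgebra.Projectivization

noncomputable section

namespace LimitMad

/-- The projective line over the field of `p`-adic numbers. -/
abbrev P1 (p : ℕ) [Fact p.Prime] : Type := ℙ ℚ_[p] (Fin 2 → ℚ_[p])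

/-- The matrix `A_a = (0 1; 1 a)`. -/
def letterMatrix (p : ℕ) [Fact p.Prime] (a : ℕ) : Matrix (Fin 2) (Fin 2) ℚ_[p] :=
  !![0, 1; 1, (a : ℚ_[p])]

theorem letterMatrix_injective (p : ℕ) [Fact p.Prime] (a : ℕ) :
    Function.Injective (Matrix.toLin' (letterMatrix p a)) := by
  rw [← LinearMap.ker_eq_bot, LinearMap.ker_eq_bot']
  intro v hv
  have h0 := congrFun hv 0
  have h1 := congrFun hv 1
  simp [letterMatrix, Matrix.mulVec, dotProduct, Fin.sum_univ_two] at h0 h1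
  funext i
  fin_cases i
  · simpa [h0] using h1
  · simpa using h0

/-- The action of `A_a` on column vectors, passed to the projective line. -/
def letterAct (p : ℕ) [Fact p.Prime] (a : ℕ) : P1 p → P1 p :=
  Projectivization.map (Matrix.toLin' (letterMatrix p a)) (letterMatrix_injective p a)

/-- The extended left shift `T(w, q) = (T w, A_{a₁} q)` on pairs of an infinite word
`w = a₁ a₂ a₃ …` and a point of the projective line; the letter `a_{i+1}` is `w i`. -/
def shift (p : ℕ) [Fact p.Prime] (x : (ℕ → ℕ) × P1 p) : (ℕ → ℕ) × P1 p :=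
  (fun i => x.1 (i + 1), letterAct p (x.1 0) x.2)

/-- The inequalities `|a q₁ + b q₂|_p · min(|q₁⁻¹|_p, |q₂⁻¹|_p) ≥ min(|a|⁻², |b|⁻²) · ε` for all
integer pairs `(a, b) ≠ (0, 0)`. Since the inverse of `0` counts as infinite in both minima, they
are written as `1 / max(|q₁|_p, |q₂|_p)` and `1 / max(a², b²)`. -/
def PBadVec (p : ℕ) [Fact p.Prime] (ε : ℝ) (q : Fin 2 → ℚ_[p]) : Prop :=
  ∀ a b : ℤ, (a, b) ≠ (0, 0) →
    ε / max ((a : ℝ) ^ 2) ((b : ℝ) ^ 2) ≤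
      ‖(a : ℚ_[p]) * q 0 + (b : ℚ_[p]) * q 1‖ / max ‖q 0‖ ‖q 1‖

/-- The points `q` of the projective line that are `p`-adically badly approximable with
constant `ε`. The choice of homogeneous coordinates is immaterial, see `mk_mem_PBad`. -/
def PBad (p : ℕ) [Fact p.Prime] (ε : ℝ) : Set (P1 p) :=
  {x | PBadVec p ε x.rep}

theorem PBadVec_smul (p : ℕ) [Fact p.Prime] (ε : ℝ) (c : ℚ_[p]) (hc : c ≠ 0)
    (q : Fin 2 → ℚ_[p]) : PBadVec p ε (c • q) ↔ PBadVec p ε q := by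
  have hc' : 0 < ‖c‖ := norm_pos_iff.mpr hc
  unfold PBadVec
  refine forall_congr' fun a => forall_congr' fun b => imp_congr_right fun _ => ?_
  have h1 : (a : ℚ_[p]) * (c • q) 0 + (b : ℚ_[p]) * (c • q) 1
      = c * ((a : ℚ_[p]) * q 0 + (b : ℚ_[p]) * q 1) := by
    simp only [Pi.smul_apply, smul_eq_mul]; ring
  have h2 : max ‖(c • q) 0‖ ‖(c • q) 1‖ = ‖c‖ * max ‖q 0‖ ‖q 1‖ := by
    simp only [Pi.smul_apply, smul_eq_mul, norm_mul]
    rw [mul_max_of_nonneg _ _ hc'.le]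
  rw [h1, h2, norm_mul, mul_div_mul_left _ _ hc'.ne']

theorem mk_mem_PBad (p : ℕ) [Fact p.Prime] (ε : ℝ) (q : Fin 2 → ℚ_[p]) (hq : q ≠ 0) :
    Projectivization.mk ℚ_[p] q hq ∈ PBad p ε ↔ PBadVec p ε q := by
  obtain ⟨c, hc⟩ := Projectivization.exists_smul_eq_mk_rep ℚ_[p] q hq
  have h : PBadVec p ε ((c : ℚ_[p]) • q) ↔ PBadVec p ε q :=
    PBadVec_smul p ε c c.ne_zero q
  have hc' : (c : ℚ_[p]) • q = (Projectivization.mk ℚ_[p] q hq).rep := hc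
  rw [hc'] at h
  exact h

/-- All letters of the word `w` lie in the alphabet `{1, 2, …, N}`. -/
def InAlphabet (N : ℕ) (w : ℕ → ℕ) : Prop :=
  ∀ i, w i ∈ Set.Icc 1 N

/-- The pairs `x = (w, q)` with `Tⁿ x ∈ {1, …, N}^ℕ × PBad_ε` for all `n`, where
`N = ⌊1/ε⌋ + 1`. -/
def LMadEps (p : ℕ) [Fact p.Prime] (ε : ℝ) : Set ((ℕ → ℕ) × P1 p) :=
  {x | ∀ n : ℕ, InAlphabet (⌊ε⁻¹⌋₊ + 1) ((shift p)^[n] x).1 ∧ ((shift p)^[n] x).2 ∈ PBad p ε}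

/-- The set **LMad**. -/
def LMad (p : ℕ) [Fact p.Prime] : Set ((ℕ → ℕ) × P1 p) :=
  {x | ∃ ε : ℝ, 0 < ε ∧ x ∈ LMadEps p ε}

/-- The set of blocks of length `n` that occur in the word `w`. -/
def blocks (w : ℕ → ℕ) (n : ℕ) : Set (Fin n → ℕ) :=
  Set.range fun i : ℕ => fun j : Fin n => w (i + j)

/-- The complexity `P(w, n)` of a word `w` over a finite alphabet: the number of distinct blocks
of length `n` that occur in `w`. -/
def complexity (w : ℕ → ℕ) (n : ℕ) : ℕ := (blocks w n).ncard

/-- `w` is periodic from some place on. -/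
def EventuallyPeriodic (w : ℕ → ℕ) : Prop :=
  ∃ m l : ℕ, 0 < l ∧ ∀ i, m ≤ i → w (i + l) = w i

/-- Sturmian words: words with exactly `n + 1` blocks of each length `n`. -/
def IsSturmian (w : ℕ → ℕ) : Prop :=
  ∀ n : ℕ, complexity w n = n + 1

end LimitMad

end

/-
After a prefix is deleted, `w` is recurrent and has exactly one right special block of each large
length `n`, which is followed by two letters `a` and `b`. Between consecutive occurrences of this
block `w` runs through one of two loops, and passing from `n` to `n + 1` changes the pair of loop
products `(x, y)` at most into `(x, x y)` or `(y x, y)`, so that these products generate a group `H`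
of unimodular matrices that does not depend on `n`. Let now `q` be a vector over `ℤ_p`. By the
pigeonhole principle, applied for each `k` to the action of `H` on vectors modulo `p ^ k`, the
`w`-orbit of `q` contains an `H`-orbit modulo `p ^ k`; by compactness its closure contains `H z` for
some `z`.

If `(w, q)` were in **LMad**, then the orbit closure would consist of vectors with coordinates that
are linearly independent over `ℤ`. But if `z` is not an eigenvector of `g = 1 + p ^ 2 E`, then an
approximation of Hensel's type finds an integral linear form that vanishes on the closure of the
vectors `g ^ n z`. So `z` would be an eigenvector of `g ^ k` for all `g` in `H`, with `k` the order
of `GL₂(ℤ/p²)`. Since the coordinates of `z` are independent, matrices with the eigenvector `z`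
commute. The powers of the two loop products do not: a product of matrices `A_c` determines its
last letter, and the loops leave with different letters.
-/

namespace LimitMad

/-! ### Loops between right special positions -/

/-- `s` and `t` are consecutive elements of `S`. -/
structure IsNext (S : Set ℕ) (s t : ℕ) : Prop where
  left_mem : s ∈ S
  right_mem : t ∈ S
  lt : s < t
  notMem : ∀ r, s < r → r < t → r ∉ S

namespace IsNext
variable {S T : Set ℕ} {r s t t' : ℕ}

theorem le_of_mem (h : IsNext S s t) (hr : r ∈ S) (hsr : s < r) : t ≤ r :=
  not_lt.1 fun hrt => h.notMem r hsr hrt hr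

theorem right_unique (h : IsNext S s t) (h' : IsNext S s t') : t = t' :=
  (h.le_of_mem h'.right_mem h'.lt).antisymm (h'.le_of_mem h.right_mem h.lt)

theorem of_subset (hTS : T ⊆ S) (h : IsNext S s t) (hs : s ∈ T) (ht : t ∈ T) : IsNext T s t :=
  ⟨hs, ht, h.lt, fun r hsr hrt hr => h.notMem r hsr hrt (hTS hr)⟩

theorem concat (hTS : T ⊆ S) (h : IsNext S s r) (h' : IsNext S r t) (hs : s ∈ T) (hr : r ∉ T)
    (ht : t ∈ T) : IsNext T s t where
  left_mem := hs
  right_mem := ht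
  lt := h.lt.trans h'.lt
  notMem q hsq hqt hq := by
    rcases (h.le_of_mem (hTS hq) hsq).eq_or_lt with rfl | hrq
    · exact hr hq
    · exact h'.notMem q hrq hqt (hTS hq)

theorem exists_left (ht : t ∈ S) (hr : r ∈ S) (hrt : r < t) : ∃ s ≥ r, IsNext S s t := by
  classical
  have hlt : Nat.findGreatest (· ∈ S) (t - 1) < t :=
    (Nat.findGreatest_le _).trans_lt (Nat.sub_one_lt_of_lt hrt)
  exact ⟨Nat.findGreatest (· ∈ S) (t - 1), Nat.le_findGreatest (Nat.le_sub_one_of_lt hrt) hr,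
    Nat.findGreatest_spec (P := (· ∈ S)) (Nat.le_sub_one_of_lt hrt) hr, ht, hlt,
    fun q hq hqt => Nat.findGreatest_is_greatest hq (Nat.le_sub_one_of_lt hqt)⟩

theorem exists_right (hs : s ∈ S) (ht : t ∈ S) (hst : s < t) : ∃ q, IsNext S s q := by
  classical
  have hex : ∃ q, s < q ∧ q ∈ S := ⟨t, hst, ht⟩
  exact ⟨Nat.find hex, hs, (Nat.find_spec hex).2, (Nat.find_spec hex).1,
    fun r hsr hr hrS => Nat.find_min hex hr ⟨hsr, hrS⟩⟩

end IsNext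

/-- The `n` letters before position `s` exist and agree with those before position `t`. -/
structure PastEq {α : Type*} (w : ℕ → α) (n s t : ℕ) : Prop where
  le_left : n ≤ s
  le_right : n ≤ t
  eq_sub : ∀ j < n, w (s - (j + 1)) = w (t - (j + 1))

/-- The positions of `w` that are preceded by a right special block of length `n`, i.e. a block
that also occurs followed by a different letter. -/
def special {α : Type*} (w : ℕ → α) (n : ℕ) : Set ℕ :=
  {t | ∃ s, PastEq w n s t ∧ w s ≠ w t}

/-- `w` returns for the first time to the right special positions of level `n` at `t` when it
leaves the right special position `s` with the letter `c`. -/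
structure IsLoop {α : Type*} (w : ℕ → α) (n : ℕ) (c : α) (s t : ℕ) : Prop
    extends IsNext (special w n) s t where
  letter : w s = c

/-- The loops of level `n` that leave with the letter `c` end in right special positions of
level `n + 1`. -/
def LoopPersists {α : Type*} (w : ℕ → α) (n : ℕ) (c : α) : Prop :=
  ∀ s t, IsLoop w n c s t → t ∈ special w (n + 1)

section
variable {α : Type*} {w : ℕ → α} {n m s t r k d : ℕ} {c : α}

namespace PastEq

theorem symm (h : PastEq w n s t) : PastEq w n t s :=
  ⟨h.le_right, h.le_left, fun j hj => (h.eq_sub j hj).symm⟩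

theorem trans (h : PastEq w n r s) (h' : PastEq w n s t) : PastEq w n r t :=
  ⟨h.le_left, h'.le_right, fun j hj => (h.eq_sub j hj).trans (h'.eq_sub j hj)⟩

theorem mono (hmn : m ≤ n) (h : PastEq w n s t) : PastEq w m s t :=
  ⟨hmn.trans h.le_left, hmn.trans h.le_right, fun j hj => h.eq_sub j (hj.trans_le hmn)⟩

theorem succ (h : PastEq w n s t) (hw : w s = w t) : PastEq w (n + 1) (s + 1) (t + 1) where
  le_left := Nat.succ_le_succ h.le_left
  le_right := Nat.succ_le_succ h.le_right
  eq_sub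
    | 0, _ => by simpa using hw
    | j + 1, hj => by simpa using h.eq_sub j (by omega)

theorem letter_eq (h : PastEq w (n + 1) (s + 1) (t + 1)) : w s = w t := by
  simpa using h.eq_sub 0 n.succ_pos

theorem pred (h : PastEq w (n + 1) (s + 1) (t + 1)) : PastEq w n s t :=
  ⟨Nat.le_of_succ_le_succ h.le_left, Nat.le_of_succ_le_succ h.le_right,
    fun j hj => by simpa using h.eq_sub (j + 1) (by omega)⟩

theorem sub (h : PastEq w n s t) (hd : m + d ≤ n) : PastEq w m (s - d) (t - d) := by
  have hs := h.le_left
  have ht := h.le_right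
  refine ⟨by omega, by omega, fun j hj => ?_⟩
  simpa only [Nat.sub_sub, add_assoc] using h.eq_sub (d + j) (by omega)

end PastEq

theorem le_of_mem_special (ht : t ∈ special w n) : n ≤ t := by
  obtain ⟨s, hs, -⟩ := ht
  exact hs.le_right

theorem special_anti (hmn : m ≤ n) : special w n ⊆ special w m :=
  fun _ ⟨s, hs, hne⟩ => ⟨s, hs.mono hmn, hne⟩

theorem PastEq.mem_special (h : PastEq w n t s) (ht : t ∈ special w n) : s ∈ special w n := by
  obtain ⟨r, hr, hne⟩ := ht
  by_cases hw : w t = w s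
  · exact ⟨r, hr.trans h, hw ▸ hne⟩
  · exact ⟨t, h, hw⟩

theorem PastEq.letter_eq_of_notMem_special (h : PastEq w n s t) (ht : t ∉ special w n) :
    w s = w t :=
  not_not.1 fun hne => ht ⟨s, h, hne⟩

/-- Away from the right special positions the past determines the next letter. -/
theorem IsNext.pastEq_add (h : IsNext (special w n) s t) (hp : PastEq w n s r)
    (hw : w s = w r) (hk : s + k < t) : PastEq w (n + 1) (s + k + 1) (r + k + 1) := by
  induction k with
  | zero => exact hp.succ hw
  | succ k ih =>
    have hpast : PastEq w n (s + (k + 1)) (r + (k + 1)) := (ih (by omega)).mono n.le_succ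
    exact hpast.succ (hpast.symm.letter_eq_of_notMem_special
      (h.notMem (s + (k + 1)) (by omega) hk)).symm

theorem IsLoop.letter_add_eq {s' : ℕ} (h : IsLoop w n c s t) (hp : PastEq w n s s')
    (hc : w s' = c) (hk : s + k < t) : w (s + k) = w (s' + k) :=
  (h.toIsNext.pastEq_add hp (h.letter.trans hc.symm) hk).letter_eq

theorem IsNext.pastEq_right (h : IsNext (special w n) s t) (hp : PastEq w n s r)
    (hw : w s = w r) : PastEq w (n + 1) t (r + (t - s)) := by
  have hst := h.lt
  have hlast := h.pastEq_add hp hw (k := t - s - 1) (by omega)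
  rwa [show s + (t - s - 1) + 1 = t by omega,
    show r + (t - s - 1) + 1 = r + (t - s) by omega] at hlast

theorem IsLoop.transport {s' : ℕ} (h : IsLoop w n c s t) (hp : PastEq w n s s')
    (hc : w s' = c) : IsLoop w n c s' (s' + (t - s)) where
  left_mem := hp.mem_special h.left_mem
  right_mem := ((h.pastEq_right hp (h.letter.trans hc.symm)).mono n.le_succ).mem_special
    h.right_mem
  lt := Nat.lt_add_of_pos_right (Nat.sub_pos_of_lt h.lt)
  notMem q hq hqt hmem := by
    obtain ⟨k, rfl⟩ := Nat.exists_eq_add_of_lt hq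
    have hpast := h.pastEq_add hp (h.letter.trans hc.symm) (k := k) (by omega)
    exact h.notMem (s + k + 1) (by omega) (by omega)
      ((hpast.mono n.le_succ).symm.mem_special hmem)
  letter := hc

theorem IsLoop.succ (h : IsLoop w n c s t) (hs : s ∈ special w (n + 1))
    (ht : t ∈ special w (n + 1)) : IsLoop w (n + 1) c s t :=
  ⟨h.toIsNext.of_subset (special_anti n.le_succ) hs ht, h.letter⟩

end

/-- Recurrent words that, from length `n₀` on, have exactly one right special block of each
length, and this block is followed by the letters `a` and `b` only. These are the words to which
words of complexity at most `n + C` reduce after deleting a prefix. -/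
structure QuasiSturmian {α : Type*} (w : ℕ → α) (n₀ : ℕ) (a b : α) : Prop where
  recurrent : ∀ t N, ∃ t' ≥ N, PastEq w t t t'
  ne : a ≠ b
  unique : ∀ n ≥ n₀, ∀ s ∈ special w n, ∀ t ∈ special w n, PastEq w n s t
  letter : ∀ t ∈ special w n₀, w t = a ∨ w t = b
  nonempty : ∀ n ≥ n₀, (special w n).Nonempty

namespace QuasiSturmian
variable {α : Type*} {w : ℕ → α} {n₀ n : ℕ} {a b c : α} {s t s' t' : ℕ}

theorem symm (h : QuasiSturmian w n₀ a b) : QuasiSturmian w n₀ b a :=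
  ⟨h.recurrent, h.ne.symm, h.unique, fun t ht => (h.letter t ht).symm, h.nonempty⟩

theorem letter_of_le (h : QuasiSturmian w n₀ a b) (hn : n₀ ≤ n) (ht : t ∈ special w n) :
    w t = a ∨ w t = b :=
  h.letter t (special_anti hn ht)

theorem exists_pastEq_letter_eq (h : QuasiSturmian w n₀ a b) (t N : ℕ) :
    ∃ t' ≥ N, PastEq w t t t' ∧ w t' = w t := by
  obtain ⟨t', ht', hp⟩ := h.recurrent (t + 1) (N + 1)
  obtain ⟨t', rfl⟩ := Nat.exists_eq_add_one.2 (Nat.zero_lt_of_lt hp.le_right)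
  exact ⟨t', Nat.le_of_succ_le_succ ht', hp.pred, hp.letter_eq.symm⟩

theorem exists_mem_special_eq_left (h : QuasiSturmian w n₀ a b) (hn : n₀ ≤ n) (N : ℕ) :
    ∃ t ≥ N, t ∈ special w n ∧ w t = a := by
  obtain ⟨r, hr, hra⟩ : ∃ r ∈ special w n, w r = a := by
    obtain ⟨t, s, hst, hne⟩ := h.nonempty n hn
    have ht : t ∈ special w n := ⟨s, hst, hne⟩
    have hs : s ∈ special w n := hst.symm.mem_special ht
    rcases h.letter_of_le hn ht, h.letter_of_le hn hs with ⟨hta | htb, hsa | hsb⟩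
    · exact ⟨t, ht, hta⟩
    · exact ⟨t, ht, hta⟩
    · exact ⟨s, hs, hsa⟩
    · exact absurd (hsb.trans htb.symm) hne
  obtain ⟨t, htN, hrt, ht⟩ := h.exists_pastEq_letter_eq r N
  exact ⟨t, htN, (hrt.mono (le_of_mem_special hr)).mem_special hr, ht.trans hra⟩

theorem exists_mem_special_ge (h : QuasiSturmian w n₀ a b) (hn : n₀ ≤ n) (N : ℕ) :
    ∃ t ≥ N, t ∈ special w n := by
  obtain ⟨t, htN, ht, -⟩ := h.exists_mem_special_eq_left hn N
  exact ⟨t, htN, ht⟩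

theorem exists_isNext (h : QuasiSturmian w n₀ a b) (hn : n₀ ≤ n) (hs : s ∈ special w n) :
    ∃ t, IsNext (special w n) s t := by
  obtain ⟨t, hst, ht⟩ := h.exists_mem_special_ge hn (s + 1)
  exact IsNext.exists_right hs ht hst

theorem exists_isLoop (h : QuasiSturmian w n₀ a b) (hn : n₀ ≤ n) :
    ∃ s t, IsLoop w n a s t := by
  obtain ⟨s, -, hs, hsa⟩ := h.exists_mem_special_eq_left hn 0
  obtain ⟨t, ht⟩ := h.exists_isNext hn hs
  exact ⟨s, t, ht, hsa⟩

theorem exists_isLoop_right (h : QuasiSturmian w n₀ a b) (hn : n₀ ≤ n) (N : ℕ) :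
    ∃ M, ∀ t ≥ M, t ∈ special w n → ∃ s ≥ N, IsLoop w n a s t ∨ IsLoop w n b s t := by
  obtain ⟨r, hrN, hr⟩ := h.exists_mem_special_ge hn N
  refine ⟨r + 1, fun t hrt ht => ?_⟩
  obtain ⟨s, hrs, hst⟩ := IsNext.exists_left ht hr hrt
  exact ⟨s, hrN.trans hrs, (h.letter_of_le hn hst.left_mem).imp (⟨hst, ·⟩) (⟨hst, ·⟩)⟩

theorem right_eq_of_isLoop (h : QuasiSturmian w n₀ a b) (hn : n₀ ≤ n) (hst : IsLoop w n c s t)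
    (hst' : IsLoop w n c s' t') : t' = s' + (t - s) :=
  hst'.right_unique
    (hst.transport (h.unique n hn s hst.left_mem s' hst'.left_mem) hst'.letter).toIsNext

theorem pastEq_of_isLoop (h : QuasiSturmian w n₀ a b) (hn : n₀ ≤ n) (hst : IsLoop w n c s t)
    (hst' : IsLoop w n c s' t') : PastEq w (n + 1) t t' := by
  rw [h.right_eq_of_isLoop hn hst hst']
  exact hst.pastEq_right (h.unique n hn s hst.left_mem s' hst'.left_mem)
    (hst.letter.trans hst'.letter.symm)

theorem notMem_of_not_loopPersists (h : QuasiSturmian w n₀ a b) (hn : n₀ ≤ n)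
    (hc : ¬ LoopPersists w n c) (hst : IsLoop w n c s t) : t ∉ special w (n + 1) :=
  fun ht => hc fun _ _ hst' => (h.pastEq_of_isLoop hn hst hst').mem_special ht

theorem loopPersists_or (h : QuasiSturmian w n₀ a b) (hn : n₀ ≤ n) :
    LoopPersists w n a ∨ LoopPersists w n b := by
  by_contra! hab
  obtain ⟨M, hM⟩ := h.exists_isLoop_right hn 0
  obtain ⟨t, htM, ht⟩ := h.exists_mem_special_ge (hn.trans n.le_succ) M
  obtain ⟨s, -, hs | hs⟩ := hM t htM (special_anti n.le_succ ht)
  · exact h.notMem_of_not_loopPersists hn hab.1 hs ht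
  · exact h.notMem_of_not_loopPersists hn hab.2 hs ht

/-- Otherwise the loop would repeat forever, since its end is not right special of level
`n + 1`. -/
theorem letter_right_eq_left (h : QuasiSturmian w n₀ a b) (hn : n₀ ≤ n)
    (hb : ¬ LoopPersists w n b) (hst : IsLoop w n b s t) : w t = a := by
  refine (h.letter_of_le hn hst.right_mem).resolve_right fun htb => ?_
  have forever : ∀ r ≥ t, r ∈ special w n → w r = b := by
    intro r
    induction r using Nat.strong_induction_on with
    | _ r ih =>
      intro htr hr
      rcases htr.eq_or_lt with rfl | htr
      · exact htb
      · obtain ⟨q, htq, hqr⟩ := IsNext.exists_left hr hst.right_mem htr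
        have hloop : IsLoop w n b q r := ⟨hqr, ih q hqr.lt htq hqr.left_mem⟩
        exact ((h.pastEq_of_isLoop hn hloop hst).letter_eq_of_notMem_special
          (h.notMem_of_not_loopPersists hn hb hst)).trans htb
  obtain ⟨r, htr, hr, hra⟩ := h.exists_mem_special_eq_left hn t
  exact h.ne (hra.symm.trans (forever r htr hr))

theorem not_periodic (h : QuasiSturmian w n₀ a b) {d : ℕ} (hd : 0 < d) :
    ¬ ∀ i, w (i + d) = w i := by
  intro hper
  obtain ⟨t, s, hst, hne⟩ := h.nonempty (max n₀ d) (le_max_left _ _)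
  have hback : ∀ r ≥ d, w r = w (r - d) := fun r hr => by
    conv_lhs => rw [← Nat.sub_add_cancel hr, hper]
  have hlast := hst.eq_sub (d - 1) ((Nat.sub_lt hd one_pos).trans_le (le_max_right _ _))
  rw [Nat.sub_add_cancel (Nat.one_le_iff_ne_zero.2 hd.ne')] at hlast
  exact hne (by rw [hback s ((le_max_right _ _).trans hst.le_left),
    hback t ((le_max_right _ _).trans hst.le_right), hlast])

theorem mem_special_of_forall_loopPersists (h : QuasiSturmian w n₀ a b) (hn : n₀ ≤ n)
    (ha : ∀ m ≥ n, LoopPersists w m a) (ht : t ∈ special w n) (htb : w t = b) {m : ℕ}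
    (hnm : n ≤ m) (hmt : m ≤ t) : t ∈ special w m := by
  induction m, hnm using Nat.le_induction with
  | base => exact ht
  | succ m hnm ih =>
    have hm := hn.trans hnm
    obtain ⟨M, hM⟩ := h.exists_isLoop_right hm 0
    obtain ⟨t', htM, htt', ht'b⟩ := h.exists_pastEq_letter_eq t M
    have ht' : t' ∈ special w m :=
      (htt'.mono (m.le_succ.trans hmt)).mem_special (ih (m.le_succ.trans hmt))
    refine (htt'.mono hmt).symm.mem_special ?_
    obtain ⟨s, -, hs | hs⟩ := hM t' htM ht'
    · exact ha m hnm s t' hs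
    · by_cases hb : LoopPersists w m b
      · exact hb s t' hs
      · exact absurd ((h.letter_right_eq_left hm hb hs).symm.trans (ht'b.trans htb)) h.ne

/-- If all the loops leaving with `a` persisted, then the past of a position at which the right
special block is followed by `b` would be right special at all levels, so `w` would be periodic
with the distance of two such positions as a period. -/
theorem exists_not_loopPersists (h : QuasiSturmian w n₀ a b) (hn : n₀ ≤ n) :
    ∃ m ≥ n, ¬ LoopPersists w m a := by
  by_contra! ha
  obtain ⟨t, -, ht, htb⟩ := h.symm.exists_mem_special_eq_left hn 0
  obtain ⟨t', htt', ht', ht'b⟩ := h.symm.exists_mem_special_eq_left hn (t + 1)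
  obtain ⟨d, rfl⟩ : ∃ d, t' = t + (d + 1) := Nat.exists_eq_add_of_lt htt'
  have hnt := le_of_mem_special ht
  refine h.not_periodic d.succ_pos fun i => ?_
  obtain ⟨r, hir, hpr, hrb⟩ := h.exists_pastEq_letter_eq (t + (d + 1)) (i + n + (d + 2))
  obtain ⟨s, rfl⟩ : ∃ s, r = s + (d + 1) := ⟨r - (d + 1), by omega⟩
  have hps : PastEq w t t s := by simpa using hpr.sub le_rfl
  have hst : w s = w t := by simpa using (hpr.eq_sub d (by omega)).symm
  have hs : s ∈ special w s := h.mem_special_of_forall_loopPersists hn ha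
    ((hps.mono hnt).mem_special ht) (hst.trans htb) (by omega) le_rfl
  have hr : s + (d + 1) ∈ special w s := h.mem_special_of_forall_loopPersists hn ha
    ((hpr.mono (by omega)).mem_special ht') (hrb.trans ht'b) (by omega) (by omega)
  have hper := (h.unique s (by omega) s hs _ hr).eq_sub (s - (i + 1)) (by omega)
  rw [show s - (s - (i + 1) + 1) = i by omega,
    show s + (d + 1) - (s - (i + 1) + 1) = i + (d + 1) by omega] at hper
  exact hper.symm

end QuasiSturmian

/-- The product `γ (w (t - 1)) * ⋯ * γ (w 0)` of the elements attached to the letters before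
position `t`. -/
def cocycle {α Γ : Type*} [Monoid Γ] (γ : α → Γ) (w : ℕ → α) : ℕ → Γ
  | 0 => 1
  | t + 1 => γ (w t) * cocycle γ w t

theorem exists_cocycle_eq_mul {α Γ : Type*} [Monoid Γ] (γ : α → Γ) (w : ℕ → α) {s t : ℕ}
    (hst : s ≤ t) :
    ∃ x ∈ Submonoid.closure (Set.range (γ ∘ w)), cocycle γ w t = x * cocycle γ w s := by
  induction t, hst using Nat.le_induction with
  | base => exact ⟨1, one_mem _, (one_mul _).symm⟩
  | succ t _ ih =>
    obtain ⟨x, hx, h⟩ := ih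
    exact ⟨γ (w t) * x, mul_mem (Submonoid.subset_closure ⟨t, rfl⟩) hx, by
      rw [cocycle, h, mul_assoc]⟩

section
variable {α Γ : Type*} [Group Γ]

theorem cocycle_mul_inv_eq (γ : α → Γ) {w : ℕ → α} {s s' d : ℕ}
    (h : ∀ k < d, w (s + k) = w (s' + k)) :
    cocycle γ w (s + d) * (cocycle γ w s)⁻¹ = cocycle γ w (s' + d) * (cocycle γ w s')⁻¹ := by
  induction d with
  | zero => simp
  | succ d ih =>
    rw [← add_assoc, ← add_assoc, cocycle, cocycle, h d d.lt_succ_self, mul_assoc, mul_assoc,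
      ih fun k hk => h k (hk.trans d.lt_succ_self)]

open Classical in
/-- The product of the elements attached to the letters of a loop of level `n` that leaves with
the letter `c`. All these loops have the same product in a quasi-Sturmian word, see
`QuasiSturmian.cocycle_of_isLoop`; the value is `1` if there is no such loop. -/
noncomputable def loopValue (γ : α → Γ) (w : ℕ → α) (n : ℕ) (c : α) : Γ :=
  if h : ∃ st : ℕ × ℕ, IsLoop w n c st.1 st.2 then
    cocycle γ w h.choose.2 * (cocycle γ w h.choose.1)⁻¹ else 1

/-- The group generated by the products of the two kinds of loops of level `n`. -/
def loopGroup (γ : α → Γ) (w : ℕ → α) (n : ℕ) (a b : α) : Subgroup Γ :=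
  Subgroup.closure {loopValue γ w n a, loopValue γ w n b}

theorem closure_pair_mul (x y : Γ) : Subgroup.closure {x, x * y} = Subgroup.closure {x, y} := by
  have hgen : ∀ u v : Γ, u ∈ Subgroup.closure {u, v} ∧ v ∈ Subgroup.closure {u, v} := fun u v =>
    ⟨Subgroup.subset_closure (.inl rfl), Subgroup.subset_closure (.inr rfl)⟩
  refine le_antisymm ?_ ?_ <;>
    rw [Subgroup.closure_le, Set.insert_subset_iff, Set.singleton_subset_iff]
  · exact ⟨(hgen x y).1, mul_mem (hgen x y).1 (hgen x y).2⟩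
  · refine ⟨(hgen x (x * y)).1, ?_⟩
    simpa using mul_mem (inv_mem (hgen x (x * y)).1) (hgen x (x * y)).2

theorem loopGroup_comm (γ : α → Γ) (w : ℕ → α) (n : ℕ) (a b : α) :
    loopGroup γ w n a b = loopGroup γ w n b a := by
  rw [loopGroup, Set.pair_comm, loopGroup]

end

namespace QuasiSturmian
section
variable {α Γ : Type*} [Group Γ] {γ : α → Γ} {w : ℕ → α} {n₀ n : ℕ} {a b c : α} {s t : ℕ}

theorem cocycle_of_isLoop (h : QuasiSturmian w n₀ a b) (γ : α → Γ) (hn : n₀ ≤ n)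
    (hst : IsLoop w n c s t) : cocycle γ w t = loopValue γ w n c * cocycle γ w s := by
  have hex : ∃ st : ℕ × ℕ, IsLoop w n c st.1 st.2 := ⟨(s, t), hst⟩
  have hloop := hex.choose_spec
  obtain ⟨d, hd⟩ := Nat.exists_eq_add_of_le hloop.lt.le
  have ht : t = s + d := by rw [h.right_eq_of_isLoop hn hloop hst, hd, Nat.add_sub_cancel_left]
  rw [loopValue, dif_pos hex, ← mul_inv_eq_iff_eq_mul, ht, hd]
  refine (cocycle_mul_inv_eq γ fun k hk => ?_).symm
  exact hloop.letter_add_eq (h.unique n hn _ hloop.left_mem s hst.left_mem) hst.letter (by omega)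

theorem exists_loopValue_eq_mul (h : QuasiSturmian w n₀ a b) (γ : α → Γ) (hn : n₀ ≤ n) :
    ∃ x ∈ Submonoid.closure (Set.range (γ ∘ w)), loopValue γ w n a = x * γ a := by
  obtain ⟨s, t, hst⟩ := h.exists_isLoop hn
  obtain ⟨x, hx, hcx⟩ := exists_cocycle_eq_mul γ w hst.lt
  rw [h.cocycle_of_isLoop γ hn hst, Nat.succ_eq_add_one, cocycle, hst.letter, ← mul_assoc] at hcx
  exact ⟨x, hx, mul_right_cancel hcx⟩

theorem loopValue_succ_of_loopPersists (h : QuasiSturmian w n₀ a b) (γ : α → Γ) (hn : n₀ ≤ n)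
    (ha : LoopPersists w n a) : loopValue γ w (n + 1) a = loopValue γ w n a := by
  have hn' : n₀ ≤ n + 1 := hn.trans n.le_succ
  obtain ⟨s, -, hs, hsa⟩ := h.exists_mem_special_eq_left hn' 0
  obtain ⟨t, hst⟩ := h.exists_isNext hn (special_anti n.le_succ hs)
  have hloop : IsLoop w n a s t := ⟨hst, hsa⟩
  refine mul_right_cancel (b := cocycle γ w s) ?_
  rw [← h.cocycle_of_isLoop γ hn hloop,
    ← h.cocycle_of_isLoop γ hn' (hloop.succ hs (ha s t hloop))]

theorem loopValue_succ_of_not_loopPersists (h : QuasiSturmian w n₀ a b) (γ : α → Γ)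
    (hn : n₀ ≤ n) (hb : ¬ LoopPersists w n b) :
    loopValue γ w (n + 1) b = loopValue γ w n a * loopValue γ w n b := by
  have hn' : n₀ ≤ n + 1 := hn.trans n.le_succ
  have ha := (h.loopPersists_or hn).resolve_right hb
  obtain ⟨s, -, hs, hsb⟩ := h.symm.exists_mem_special_eq_left hn' 0
  obtain ⟨r, hsr⟩ := h.exists_isNext hn (special_anti n.le_succ hs)
  have hloop : IsLoop w n b s r := ⟨hsr, hsb⟩
  obtain ⟨t, hrt⟩ := h.exists_isNext hn hsr.right_mem
  have hloop' : IsLoop w n a r t := ⟨hrt, h.letter_right_eq_left hn hb hloop⟩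
  have hconcat : IsLoop w (n + 1) b s t := ⟨hsr.concat (special_anti n.le_succ) hrt hs
    (h.notMem_of_not_loopPersists hn hb hloop) (ha r t hloop'), hsb⟩
  refine mul_right_cancel (b := cocycle γ w s) ?_
  rw [mul_assoc, ← h.cocycle_of_isLoop γ hn hloop, ← h.cocycle_of_isLoop γ hn hloop',
    ← h.cocycle_of_isLoop γ hn' hconcat]

theorem loopGroup_succ (h : QuasiSturmian w n₀ a b) (γ : α → Γ) (hn : n₀ ≤ n) :
    loopGroup γ w (n + 1) a b = loopGroup γ w n a b := by
  wlog ha : LoopPersists w n a generalizing a b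
  · rw [loopGroup_comm, loopGroup_comm _ _ n]
    exact this h.symm ((h.loopPersists_or hn).resolve_left ha)
  rw [loopGroup, loopGroup, h.loopValue_succ_of_loopPersists γ hn ha]
  by_cases hb : LoopPersists w n b
  · rw [h.symm.loopValue_succ_of_loopPersists γ hn hb]
  · rw [h.loopValue_succ_of_not_loopPersists γ hn hb, closure_pair_mul]

theorem loopGroup_eq (h : QuasiSturmian w n₀ a b) (γ : α → Γ) (hn : n₀ ≤ n) :
    loopGroup γ w n a b = loopGroup γ w n₀ a b := by
  induction n, hn using Nat.le_induction with
  | base => rfl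
  | succ n hn ih => rw [h.loopGroup_succ γ hn, ih]

end
end QuasiSturmian

section
open Filter
variable {α Γ X : Type*} [Group Γ] [MulAction Γ X]

/-- The points that the orbit of `x₀` along the cocycle visits at infinitely many right special
positions of level `n`. -/
def limitPoints (γ : α → Γ) (w : ℕ → α) (x₀ : X) (n : ℕ) : Set X :=
  {x | ∃ᶠ t in atTop, t ∈ special w n ∧ cocycle γ w t • x₀ = x}

theorem limitPoints_antitone (γ : α → Γ) (w : ℕ → α) (x₀ : X) :
    Antitone (limitPoints γ w x₀) :=
  fun _ _ hmn _ hx => hx.mono fun _ ht => ⟨special_anti hmn ht.1, ht.2⟩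

theorem exists_limitPoints_eq [Finite X] (γ : α → Γ) (w : ℕ → α) (x₀ : X) :
    ∃ m, ∀ n ≥ m, limitPoints γ w x₀ n = limitPoints γ w x₀ m := by
  obtain ⟨m, hm⟩ := WellFoundedGT.monotone_chain_condition
    ⟨fun n => OrderDual.toDual (limitPoints γ w x₀ n), limitPoints_antitone γ w x₀⟩
  exact ⟨m, fun n hn => (hm n hn).symm⟩

namespace QuasiSturmian
open scoped Pointwise
variable {γ : α → Γ} {w : ℕ → α} {n₀ n m : ℕ} {a b : α} {x₀ : X} [Finite X]

theorem limitPoints_nonempty (h : QuasiSturmian w n₀ a b) (γ : α → Γ) (x₀ : X) (hn : n₀ ≤ n) :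
    (limitPoints γ w x₀ n).Nonempty := by
  by_contra hempty
  have hnever : ∀ x, ∀ᶠ t in atTop, ¬ (t ∈ special w n ∧ cocycle γ w t • x₀ = x) := fun x =>
    not_frequently.1 fun hx => hempty ⟨x, hx⟩
  obtain ⟨N, hN⟩ := eventually_atTop.1 (eventually_all.2 hnever)
  obtain ⟨t, htN, ht⟩ := h.exists_mem_special_ge hn N
  exact hN t htN _ ⟨ht, rfl⟩

theorem loopValue_mem_stabilizer (h : QuasiSturmian w n₀ a b) (hn : n₀ ≤ n)
    (hb : ¬ LoopPersists w n b)
    (hK : limitPoints γ w x₀ n ⊆ limitPoints γ w x₀ (n + 1)) :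
    loopValue γ w n a ∈ MulAction.stabilizer Γ (limitPoints γ w x₀ n) := by
  rw [← inv_mem_iff, MulAction.mem_stabilizer_set' (Set.toFinite _)]
  refine fun x hx => frequently_atTop.2 fun N => ?_
  obtain ⟨M, hM⟩ := h.exists_isLoop_right hn N
  obtain ⟨t, htM, ht, htx⟩ := frequently_atTop.1 (hK hx) M
  obtain ⟨s, hsN, hs | hs⟩ := hM t htM (special_anti n.le_succ ht)
  · refine ⟨s, hsN, hs.left_mem, ?_⟩
    rw [← htx, h.cocycle_of_isLoop γ hn hs, mul_smul, inv_smul_smul]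
  · exact absurd ht (h.notMem_of_not_loopPersists hn hb hs)

theorem loopGroup_le_stabilizer (h : QuasiSturmian w n₀ a b) (hm : n₀ ≤ m)
    (hK : ∀ n ≥ m, limitPoints γ w x₀ n = limitPoints γ w x₀ m) :
    loopGroup γ w n₀ a b ≤ MulAction.stabilizer Γ (limitPoints γ w x₀ m) := by
  have hsub : ∀ n ≥ m, limitPoints γ w x₀ n ⊆ limitPoints γ w x₀ (n + 1) := fun n hn =>
    ((hK n hn).trans (hK (n + 1) (hn.trans n.le_succ)).symm).subset
  obtain ⟨k, hk, hkb⟩ := h.symm.exists_not_loopPersists hm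
  have hstab : ∀ n ≥ k, loopValue γ w n a ∈ MulAction.stabilizer Γ (limitPoints γ w x₀ m) := by
    intro n hn
    induction n, hn using Nat.le_induction with
    | base => exact hK k hk ▸ h.loopValue_mem_stabilizer (hm.trans hk) hkb (hsub k hk)
    | succ n hn ih =>
      have hmn := hk.trans hn
      by_cases ha : LoopPersists w n a
      · rwa [h.loopValue_succ_of_loopPersists γ (hm.trans hmn) ha]
      · rw [h.symm.loopValue_succ_of_not_loopPersists γ (hm.trans hmn) ha]
        exact mul_mem
          (hK n hmn ▸ h.symm.loopValue_mem_stabilizer (hm.trans hmn) ha (hsub n hmn)) ih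
  obtain ⟨n, hn, hna⟩ := h.exists_not_loopPersists (hm.trans hk)
  have hmn := hk.trans hn
  rw [← h.loopGroup_eq γ (hm.trans hmn), loopGroup, Subgroup.closure_le, Set.insert_subset_iff,
    Set.singleton_subset_iff]
  exact ⟨hstab n hn,
    hK n hmn ▸ h.symm.loopValue_mem_stabilizer (hm.trans hmn) hna (hsub n hmn)⟩

theorem exists_loopGroup_smul_subset (h : QuasiSturmian w n₀ a b) (γ : α → Γ) (x₀ : X) :
    ∃ s, ∀ g ∈ loopGroup γ w n₀ a b, ∃ t, cocycle γ w t • x₀ = g • cocycle γ w s • x₀ := by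
  obtain ⟨m, hm⟩ := exists_limitPoints_eq γ w x₀
  have hK : ∀ n ≥ max n₀ m, limitPoints γ w x₀ n = limitPoints γ w x₀ (max n₀ m) := fun n hn =>
    (hm n ((le_max_right _ _).trans hn)).trans (hm _ (le_max_right _ _)).symm
  obtain ⟨x, hx⟩ := h.limitPoints_nonempty γ x₀ (le_max_left n₀ m)
  obtain ⟨s, -, rfl⟩ := hx.exists
  refine ⟨s, fun g hg => ?_⟩
  have hgx := (MulAction.mem_stabilizer_set' (Set.toFinite _)).1
    (h.loopGroup_le_stabilizer (le_max_left _ _) hK hg) hx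
  obtain ⟨t, -, ht⟩ := hgx.exists
  exact ⟨t, ht⟩

end QuasiSturmian
end

/-! ### Words of complexity at most `n + C` -/

section
variable {w : ℕ → ℕ} {n i j : ℕ}

/-- The block of length `n` of `w` that starts at position `i`. -/
def block (w : ℕ → ℕ) (n i : ℕ) : Fin n → ℕ := fun k => w (i + k)

theorem block_mem_blocks (w : ℕ → ℕ) (n i : ℕ) : block w n i ∈ blocks w n := ⟨i, rfl⟩

theorem block_eq_iff : block w n i = block w n j ↔ ∀ k < n, w (i + k) = w (j + k) :=
  ⟨fun h k hk => congrFun h ⟨k, hk⟩, fun h => funext fun k => h k k.2⟩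

theorem block_succ_eq_iff :
    block w (n + 1) i = block w (n + 1) j ↔ block w n i = block w n j ∧ w (i + n) = w (j + n) := by
  simp only [block_eq_iff, Nat.forall_lt_succ_right]

theorem block_add_one_eq (h : block w (n + 1) i = block w (n + 1) j) :
    block w n (i + 1) = block w n (j + 1) :=
  block_eq_iff.2 fun k hk => by
    simpa only [add_assoc, add_comm 1] using block_eq_iff.1 h (k + 1) (Nat.succ_lt_succ hk)

theorem pastEq_add_iff : PastEq w n (i + n) (j + n) ↔ block w n i = block w n j := by
  refine ⟨fun h => block_eq_iff.2 fun k hk => ?_, fun h => ⟨n.le_add_left i, n.le_add_left j,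
    fun k hk => ?_⟩⟩
  · have hk' := h.eq_sub (n - (k + 1)) (by omega)
    rwa [show i + n - (n - (k + 1) + 1) = i + k by omega,
      show j + n - (n - (k + 1) + 1) = j + k by omega] at hk'
  · have hk' := block_eq_iff.1 h (n - (k + 1)) (by omega)
    rwa [← Nat.add_sub_assoc hk, ← Nat.add_sub_assoc hk] at hk'

theorem image_init_blocks (w : ℕ → ℕ) (n : ℕ) :
    (Fin.init : (Fin (n + 1) → ℕ) → Fin n → ℕ) '' blocks w (n + 1) = blocks w n :=
  (Set.range_comp _ _).symm

theorem finite_blocks (hw : (Set.range w).Finite) (n : ℕ) : (blocks w n).Finite :=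
  (Set.Finite.pi' fun _ : Fin n => hw).subset (by rintro _ ⟨i, rfl⟩ j; exact ⟨i + j, rfl⟩)

theorem complexity_zero (w : ℕ → ℕ) : complexity w 0 = 1 :=
  Set.ncard_eq_one.2 ⟨block w 0 0, Set.eq_singleton_iff_unique_mem.2
    ⟨block_mem_blocks w 0 0, fun _ _ => Subsingleton.elim _ _⟩⟩

theorem EventuallyPeriodic.exists_complexity_le (h : EventuallyPeriodic w) :
    ∃ B, ∀ n, complexity w n ≤ B := by
  obtain ⟨m, l, hl, hper⟩ := h
  refine ⟨m + l, fun n => ?_⟩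
  have hsub : blocks w n ⊆ block w n '' Set.Iio (m + l) := by
    rintro _ ⟨i, rfl⟩
    induction i using Nat.strong_induction_on with
    | _ i ih =>
      obtain hi | hi := lt_or_ge i (m + l)
      · exact ⟨i, hi, rfl⟩
      · obtain ⟨i, rfl⟩ := Nat.exists_eq_add_of_le' ((Nat.le_add_left l m).trans hi)
        obtain ⟨q, hq, hqi⟩ := ih i (by omega)
        refine ⟨q, hq, hqi.trans (funext fun k => ?_)⟩
        exact ((congrArg w (add_right_comm i l k)).trans (hper (i + k) (by omega))).symm
  calc complexity w n ≤ (block w n '' Set.Iio (m + l)).ncard :=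
        Set.ncard_le_ncard hsub ((Set.finite_Iio _).image _)
    _ ≤ (Set.Iio (m + l)).ncard := Set.ncard_image_le (Set.finite_Iio _)
    _ = m + l := by rw [← Finset.coe_Iio, Set.ncard_coe_finset, Nat.card_Iio]

/-- If no block of length `n` could be prolonged in two ways, then two occurrences of the same
block would be followed by the same infinite word. -/
theorem complexity_lt_succ (hw : (Set.range w).Finite) (hper : ¬ EventuallyPeriodic w) (n : ℕ) :
    complexity w n < complexity w (n + 1) := by
  by_contra! hle
  have hinj : Set.InjOn (Fin.init : (Fin (n + 1) → ℕ) → Fin n → ℕ) (blocks w (n + 1)) := by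
    refine Set.injOn_of_ncard_image_eq ((Set.ncard_image_le (finite_blocks hw _)).antisymm ?_)
      (finite_blocks hw _)
    rwa [image_init_blocks]
  have hprolong : ∀ p q, block w n p = block w n q → block w (n + 1) p = block w (n + 1) q :=
    fun p q h => hinj (block_mem_blocks w _ p) (block_mem_blocks w _ q) h
  obtain ⟨i, -, j, -, hij, he⟩ := Set.infinite_univ.exists_lt_map_eq_of_mapsTo
    (fun i _ => block_mem_blocks w n i) (finite_blocks hw n)
  have hfuture : ∀ k, block w n (i + k) = block w n (j + k) := by
    intro k
    induction k with
    | zero => exact he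
    | succ k ih => exact block_add_one_eq (hprolong _ _ ih)
  obtain ⟨l, rfl⟩ := Nat.exists_eq_add_of_lt hij
  refine hper ⟨i + n, l + 1, l.succ_pos, fun k hk => ?_⟩
  obtain ⟨k, rfl⟩ := Nat.exists_eq_add_of_le hk
  have hletter := (block_succ_eq_iff.1 (hprolong _ _ (hfuture k))).2
  rw [show i + n + k = i + k + n by ring, hletter]
  congr 1
  ring

theorem exists_unique_pair_of_ncard_eq {α β : Type*} {f : α → β} {S : Set α} (hS : S.Finite)
    (h : S.ncard = (f '' S).ncard + 1) :
    ∃ x ∈ S, ∃ y ∈ S, x ≠ y ∧ f x = f y ∧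
      ∀ u ∈ S, ∀ v ∈ S, u ≠ v → f u = f v → s(u, v) = s(x, y) := by
  have hnotinj : ¬ Set.InjOn f S := fun hinj => by
    rw [hinj.ncard_image] at h
    omega
  have hinj : ∀ x ∈ S, ∀ y ∈ S, x ≠ y → f x = f y → Set.InjOn f (S \ {x}) := by
    intro x hx y hy hne hf
    have himage : f '' (S \ {x}) = f '' S := by
      refine (Set.image_mono Set.sdiff_subset).antisymm ?_
      rintro _ ⟨u, hu, rfl⟩
      by_cases hux : u = x
      · exact ⟨y, ⟨hy, hne.symm⟩, by rw [hux, hf]⟩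
      · exact ⟨u, ⟨hu, hux⟩, rfl⟩
    refine Set.injOn_of_ncard_image_eq ?_ (hS.subset Set.sdiff_subset)
    rw [himage]
    exact Nat.succ_injective (h.symm.trans (Set.ncard_sdiff_singleton_add_one hx hS).symm)
  simp only [Set.InjOn, not_forall, exists_prop] at hnotinj
  obtain ⟨x, hx, y, hy, hf, hne : x ≠ y⟩ := hnotinj
  refine ⟨x, hx, y, hy, hne, hf, fun u hu v hv huv he => ?_⟩
  have hxuv : u = x ∨ v = x := by
    by_contra! hcon
    exact huv (hinj x hx y hy hne hf ⟨hu, hcon.1⟩ ⟨hv, hcon.2⟩ he)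
  have hyuv : u = y ∨ v = y := by
    by_contra! hcon
    exact huv (hinj y hy x hx hne.symm hf.symm ⟨hu, hcon.1⟩ ⟨hv, hcon.2⟩ he)
  rw [Sym2.eq_iff]
  grind

theorem exists_letters_of_complexity_succ (hw : (Set.range w).Finite)
    (h : complexity w (n + 1) = complexity w n + 1) :
    ∃ a b, a ≠ b ∧ (special w n).Nonempty ∧
      (∀ s ∈ special w n, ∀ t ∈ special w n, PastEq w n s t) ∧
      ∀ t ∈ special w n, w t = a ∨ w t = b := by
  obtain ⟨_, ⟨i, rfl⟩, _, ⟨j, rfl⟩, hne, hij, hpair⟩ :=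
    exists_unique_pair_of_ncard_eq (f := Fin.init) (finite_blocks hw (n + 1))
      (by rw [image_init_blocks]; exact h)
  change block w (n + 1) i ≠ block w (n + 1) j at hne
  change block w n i = block w n j at hij
  have hletter : w (i + n) ≠ w (j + n) := fun hlast => hne (block_succ_eq_iff.2 ⟨hij, hlast⟩)
  have hspecial : ∀ t ∈ special w n,
      PastEq w n (i + n) t ∧ (w t = w (i + n) ∨ w t = w (j + n)) := by
    rintro t ⟨s, hst, hne⟩
    obtain ⟨p, rfl⟩ := Nat.exists_eq_add_of_le' hst.le_left
    obtain ⟨q, rfl⟩ := Nat.exists_eq_add_of_le' hst.le_right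
    have hpq := hpair _ (block_mem_blocks w (n + 1) p) _ (block_mem_blocks w (n + 1) q)
      (fun he => hne (block_succ_eq_iff.1 he).2) (pastEq_add_iff.1 hst)
    rw [pastEq_add_iff]
    rcases Sym2.eq_iff.1 hpq with ⟨-, hq⟩ | ⟨-, hq⟩
    · have hqj := block_succ_eq_iff.1 hq
      exact ⟨hij.trans hqj.1.symm, .inr hqj.2⟩
    · have hqi := block_succ_eq_iff.1 hq
      exact ⟨hqi.1.symm, .inl hqi.2⟩
  exact ⟨w (i + n), w (j + n), hletter, ⟨i + n, j + n, pastEq_add_iff.2 hij.symm, hletter.symm⟩,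
    fun s hs t ht => (hspecial s hs).1.symm.trans (hspecial t ht).1, fun t ht => (hspecial t ht).2⟩

theorem exists_complexity_eq_add {B : ℕ} (hw : (Set.range w).Finite)
    (hper : ¬ EventuallyPeriodic w) (hB : ∀ n, complexity w n ≤ n + B) :
    ∃ D n₀, ∀ n ≥ n₀, complexity w n = n + D := by
  have hlt := complexity_lt_succ hw hper
  have hge : ∀ n, n ≤ complexity w n := fun _ => (strictMono_nat_of_lt_succ hlt).le_apply
  have hmono : Monotone fun n => complexity w n - n :=
    monotone_nat_of_le_succ fun n => by have := hlt n; omega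
  obtain ⟨_, ⟨n₀, rfl⟩, hmax⟩ := BddAbove.exists_isGreatest_of_nonempty
    (S := Set.range fun n => complexity w n - n)
    ⟨B, Set.forall_mem_range.2 fun n => Nat.sub_le_iff_le_add'.2 (hB n)⟩ (Set.range_nonempty _)
  refine ⟨complexity w n₀ - n₀, n₀, fun n hn => ?_⟩
  have hn₀ : complexity w n₀ - n₀ = complexity w n - n := (hmono hn).antisymm (hmax ⟨n, rfl⟩)
  rw [hn₀, Nat.add_sub_cancel' (hge n)]

/-- The word without its first `i` letters. -/
def tail {α : Type*} (w : ℕ → α) (i : ℕ) : ℕ → α := fun k => w (i + k)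

theorem range_tail_finite (hw : (Set.range w).Finite) (i : ℕ) : (Set.range (tail w i)).Finite :=
  hw.subset (Set.range_comp_subset_range (i + ·) w)

theorem not_eventuallyPeriodic_tail (hper : ¬ EventuallyPeriodic w) (i : ℕ) :
    ¬ EventuallyPeriodic (tail w i) := by
  rintro ⟨m, l, hl, h⟩
  refine hper ⟨i + m, l, hl, fun k hk => ?_⟩
  obtain ⟨k, rfl⟩ := Nat.exists_eq_add_of_le ((Nat.le_add_right i m).trans hk)
  exact (congrArg w (add_assoc i k l)).trans (h k (by omega))

theorem blocks_tail_subset (w : ℕ → ℕ) (n : ℕ) (hij : i ≤ j) :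
    blocks (tail w j) n ⊆ blocks (tail w i) n := by
  obtain ⟨d, rfl⟩ := Nat.exists_eq_add_of_le hij
  rintro _ ⟨k, rfl⟩
  exact ⟨d + k, funext fun q => congrArg w (by ring)⟩

/-- The tail is chosen with the least possible value of `D`. -/
theorem exists_tail_complexity_eq {B : ℕ} (hw : (Set.range w).Finite)
    (hper : ¬ EventuallyPeriodic w) (hB : ∀ n, complexity w n ≤ n + B) :
    ∃ i D n₀, (∀ n ≥ n₀, complexity (tail w i) n = n + D) ∧
      ∀ j ≥ i, ∀ n, blocks (tail w j) n = blocks (tail w i) n := by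
  classical
  have hmono : ∀ {i j} n, i ≤ j → complexity (tail w j) n ≤ complexity (tail w i) n :=
    fun n hij => Set.ncard_le_ncard (blocks_tail_subset w n hij)
      (finite_blocks (range_tail_finite hw _) n)
  have hzero : tail w 0 = w := funext fun k => congrArg w (zero_add k)
  have htail : ∀ i, ∃ D n₀, ∀ n ≥ n₀, complexity (tail w i) n = n + D := fun i =>
    exists_complexity_eq_add (range_tail_finite hw i) (not_eventuallyPeriodic_tail hper i)
      fun n => (hmono n i.zero_le).trans (hzero.symm ▸ hB n)
  have hex : ∃ D i n₀, ∀ n ≥ n₀, complexity (tail w i) n = n + D := ⟨_, 0, (htail 0).choose_spec⟩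
  obtain ⟨i, n₀, hi⟩ := Nat.find_spec hex
  refine ⟨i, Nat.find hex, n₀, hi, fun j hij n => (blocks_tail_subset w n hij).antisymm ?_⟩
  obtain ⟨D', n₁, hj⟩ := htail j
  have hD' : Nat.find hex ≤ D' := Nat.find_min' hex ⟨j, n₁, hj⟩
  obtain ⟨m, hnm, hm₀, hm₁⟩ : ∃ m, n ≤ m ∧ n₀ ≤ m ∧ n₁ ≤ m := ⟨n + n₀ + n₁, by omega⟩
  have hlong : blocks (tail w j) m = blocks (tail w i) m := by
    refine Set.eq_of_subset_of_ncard_le (blocks_tail_subset w m hij) ?_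
      (finite_blocks (range_tail_finite hw _) m)
    change complexity _ m ≤ complexity _ m
    rw [hi m hm₀, hj m hm₁]
    exact Nat.add_le_add_left hD' m
  rintro _ ⟨k, rfl⟩
  obtain ⟨q, hq⟩ := hlong.symm.subset (block_mem_blocks _ m k)
  exact ⟨q, funext fun r => congrFun hq (r.castLE hnm)⟩

theorem exists_quasiSturmian_tail {B : ℕ} (hw : (Set.range w).Finite)
    (hper : ¬ EventuallyPeriodic w) (hB : ∀ n, complexity w n ≤ n + B) :
    ∃ i n₀ a b, QuasiSturmian (tail w i) n₀ a b := by
  obtain ⟨i, D, n₀, hD, hblocks⟩ := exists_tail_complexity_eq hw hper hB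
  have hletters := fun n (hn : n ≥ n₀) =>
    exists_letters_of_complexity_succ (n := n) (range_tail_finite hw i)
      (by rw [hD n hn, hD (n + 1) (hn.trans n.le_succ), add_right_comm])
  obtain ⟨a, b, hab, -, -, hletter⟩ := hletters n₀ le_rfl
  refine ⟨i, n₀, a, b, fun t N => ?_, hab, fun n hn => ?_, hletter, fun n hn => ?_⟩
  · obtain ⟨q, hq⟩ := (hblocks (i + N) (Nat.le_add_right i N) t).symm.subset
      (block_mem_blocks (tail w i) t 0)
    refine ⟨N + q + t, by omega, ?_⟩
    have hpast : PastEq (tail w i) t (0 + t) (N + q + t) := by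
      refine pastEq_add_iff.2 (hq.symm.trans (funext fun k => congrArg w ?_))
      ring
    rwa [zero_add] at hpast
  · obtain ⟨_, _, _, -, hunique, -⟩ := hletters n hn
    exact hunique
  · obtain ⟨_, _, _, hnonempty, -⟩ := hletters n hn
    exact hnonempty

end

/-! ### Approximation of zeros of linear forms along powers of `1 + p ^ 2 E` -/

theorem exists_one_add_sq_mul_pow {R : Type*} [CommRing R] (p : ℕ) (x : R) (i l : ℕ) :
    ∃ g, (1 + (p : R) ^ 2 * x) ^ (p ^ i * l) = 1 + (p : R) ^ (i + 2) * (l * x + p * g) := by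
  suffices h : ∃ g, (1 + (p : R) ^ 2 * x) ^ p ^ i = 1 + (p : R) ^ (i + 2) * (x + p * g) by
    obtain ⟨g, hg⟩ := h
    obtain ⟨k, hk⟩ := Polynomial.powAddExpansion (1 : R) ((p : R) ^ (i + 2) * (x + p * g)) l
    refine ⟨l * g + k * (p : R) ^ (i + 1) * (x + p * g) ^ 2, ?_⟩
    rw [pow_mul, hg, hk]
    ring
  induction i with
  | zero => exact ⟨0, by simp⟩
  | succ i ih =>
    obtain ⟨g, hg⟩ := ih
    obtain ⟨k, hk⟩ := Polynomial.powAddExpansion (1 : R) ((p : R) ^ (i + 2) * (x + p * g)) p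
    refine ⟨g + k * (p : R) ^ i * (x + p * g) ^ 2, ?_⟩
    rw [pow_succ p i, pow_mul, hg, hk]
    ring

section
variable {p : ℕ} [Fact p.Prime]

theorem exists_natCast_pow_dvd_sub (x : ℤ_[p]) (k : ℕ) :
    ∃ l : ℕ, (p : ℤ_[p]) ^ k ∣ x - l :=
  ⟨x.appr k, Ideal.mem_span_singleton.1 (PadicInt.appr_spec k x)⟩

theorem exists_map_mul_pow_eq {A : Type*} [CommRing A] (Λ : A →+ ℤ_[p]) {x : A} {c : ℕ}
    {η : ℤ_[p]} (hΛ : ∀ g, (p : ℤ_[p]) ^ c ∣ Λ g)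
    (hx : (p : ℤ_[p]) ^ (c + 1) ∣ Λ x - (p : ℤ_[p]) ^ c * η) (n : ℕ) :
    ∃ r, Λ (x * (1 + (p : A) ^ 2 * x) ^ n) = (p : ℤ_[p]) ^ c * (η + p * r) := by
  obtain ⟨g, hg⟩ := exists_one_add_sq_mul_pow p x 0 n
  obtain ⟨r, hr⟩ := hx
  obtain ⟨r', hr'⟩ := hΛ (x * (n * x + p * g))
  have hpow : x * (1 + (p : A) ^ 2 * x) ^ n = x + p ^ 2 • (x * (n * x + p * g)) := by
    rw [pow_zero, one_mul] at hg
    rw [hg, nsmul_eq_mul]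
    push_cast
    ring
  refine ⟨r + p * r', ?_⟩
  rw [hpow, map_add, map_nsmul, hr', nsmul_eq_mul]
  push_cast
  linear_combination hr

/-- Since `Λ ((1 + p² x) ^ (p ^ i * l) * h) ≡ Λ h + p ^ (i + 2) * l * Λ (x * h)` to a higher power
of `p`, the values of `Λ` on the powers of `1 + p² x` are corrected digit by digit as in Hensel's
lemma. -/
theorem exists_pow_dvd_map_pow {A : Type*} [CommRing A] (Λ : A →+ ℤ_[p]) {x : A} {c : ℕ}
    {η : ℤ_[p]} (hη : IsUnit η) (hΛ : ∀ g, (p : ℤ_[p]) ^ c ∣ Λ g)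
    (h₁ : (p : ℤ_[p]) ^ (c + 2) ∣ Λ 1)
    (hx : (p : ℤ_[p]) ^ (c + 1) ∣ Λ x - (p : ℤ_[p]) ^ c * η) (i : ℕ) :
    ∃ n, (p : ℤ_[p]) ^ (c + 2 + i) ∣ Λ ((1 + (p : A) ^ 2 * x) ^ n) := by
  induction i with
  | zero => exact ⟨0, by simpa using h₁⟩
  | succ i ih =>
    obtain ⟨n, q, hq⟩ := ih
    obtain ⟨η', hη'⟩ := hη.exists_left_inv
    obtain ⟨l, z, hl⟩ := exists_natCast_pow_dvd_sub (-q * η') 1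
    obtain ⟨g, hg⟩ := exists_one_add_sq_mul_pow p x i l
    obtain ⟨r, hr⟩ := exists_map_mul_pow_eq Λ hΛ hx n
    set h := (1 + (p : A) ^ 2 * x) ^ n
    obtain ⟨r', hr'⟩ := hΛ (g * h)
    have hpow : (1 + (p : A) ^ 2 * x) ^ (n + p ^ i * l) =
        h + (p ^ (i + 2) * l) • (x * h) + p ^ (i + 3) • (g * h) := by
      rw [pow_add, hg, nsmul_eq_mul, nsmul_eq_mul]
      push_cast
      ring
    refine ⟨n + p ^ i * l, -z * η + l * r + r', ?_⟩
    rw [hpow, map_add, map_add, map_nsmul, map_nsmul, hr, hr', hq, nsmul_eq_mul, nsmul_eq_mul]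
    push_cast
    linear_combination (-(p : ℤ_[p]) ^ (c + 2 + i)) * (η * hl + q * hη')

end

open Polynomial in
theorem exists_aeval_eq_add {R : Type*} [CommRing R] (E : Matrix (Fin 2) (Fin 2) R) (f : R[X]) :
    ∃ u v : R, aeval E f = u • (1 : Matrix (Fin 2) (Fin 2) R) + v • E := by
  nontriviality R
  have hdeg : (f %ₘ E.charpoly).natDegree ≤ 1 := by
    have h := natDegree_modByMonic_lt f E.charpoly_monic (by
      intro h
      simpa [h] using E.charpoly_natDegree_eq_dim)
    rw [E.charpoly_natDegree_eq_dim, Fintype.card_fin] at h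
    exact Nat.le_of_lt_succ h
  obtain ⟨v, u, huv⟩ := exists_eq_X_add_C_of_natDegree_le_one hdeg
  refine ⟨u, v, ?_⟩
  rw [E.aeval_eq_aeval_mod_charpoly, huv, map_add, map_mul, aeval_C, aeval_C, aeval_X,
    Algebra.algebraMap_eq_smul_one, Algebra.algebraMap_eq_smul_one, smul_one_mul, add_comm]

open scoped Matrix.Module

section
variable {p : ℕ} [Fact p.Prime]

open Polynomial in
theorem exists_pow_dvd_map_one_add_sq_mul_pow_smul (L : (Fin 2 → ℤ_[p]) →+ ℤ_[p])
    {y : Fin 2 → ℤ_[p]} {E : Matrix (Fin 2) (Fin 2) ℤ} {c : ℕ} {η : ℤ_[p]} (hη : IsUnit η)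
    (hy : (p : ℤ_[p]) ^ (c + 2) ∣ L y)
    (hE : (p : ℤ_[p]) ^ (c + 1) ∣ L (E • y) - (p : ℤ_[p]) ^ c * η) (i : ℕ) :
    ∃ n, (p : ℤ_[p]) ^ i ∣ L ((1 + (p : Matrix (Fin 2) (Fin 2) ℤ) ^ 2 * E) ^ n • y) := by
  let Λ : ℤ[X] →+ ℤ_[p] := L.comp ((smulAddHom _ _).flip y |>.comp (aeval E).toAddMonoidHom)
  have hΛ (f : ℤ[X]) : Λ f = L (aeval E f • y) := rfl
  have hdvd (f : ℤ[X]) : (p : ℤ_[p]) ^ c ∣ Λ f := by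
    obtain ⟨u, v, huv⟩ := exists_aeval_eq_add E f
    have hcE : (p : ℤ_[p]) ^ c ∣ L (E • y) :=
      (dvd_sub_left (dvd_mul_right _ _)).1 ((pow_dvd_pow _ c.le_succ).trans hE)
    have hcy : (p : ℤ_[p]) ^ c ∣ L y := (pow_dvd_pow _ (by omega)).trans hy
    rw [hΛ, huv, add_smul, smul_assoc, smul_assoc, one_smul, map_add, map_zsmul, map_zsmul]
    exact dvd_add (dvd_smul_of_dvd u hcy) (dvd_smul_of_dvd v hcE)
  obtain ⟨n, hn⟩ := exists_pow_dvd_map_pow Λ hη hdvd (x := X) (by rwa [hΛ, map_one, one_smul])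
    (by rwa [hΛ, aeval_X]) i
  refine ⟨n, (pow_dvd_pow _ (Nat.le_add_left i (c + 2))).trans ?_⟩
  rwa [hΛ, map_pow, map_add, map_one, map_mul, map_pow, map_natCast, aeval_X] at hn

/-- The form is an integral approximation of `v ↦ y₀ v₁ - y₁ v₀`. -/
theorem exists_forall_pow_dvd_of_not_eigenvector {y : Fin 2 → ℤ_[p]}
    {E : Matrix (Fin 2) (Fin 2) ℤ} (hy : y 0 * (E • y) 1 ≠ y 1 * (E • y) 0) :
    ∃ α : Fin 2 → ℤ, α ≠ 0 ∧ ∀ i : ℕ, ∃ n,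
      (p : ℤ_[p]) ^ i ∣ ∑ j, α j • ((1 + (p : Matrix (Fin 2) (Fin 2) ℤ) ^ 2 * E) ^ n • y) j := by
  obtain ⟨c, η, hη⟩ : ∃ (c : ℕ) (η : ℤ_[p]ˣ), y 0 * (E • y) 1 - y 1 * (E • y) 0 = η * p ^ c :=
    ⟨_, _, PadicInt.unitCoeff_spec (sub_ne_zero.2 hy)⟩
  choose l hl using fun j => exists_natCast_pow_dvd_sub (y j) (c + 2)
  set α : Fin 2 → ℤ := ![-l 1, l 0] with hα
  let L : (Fin 2 → ℤ_[p]) →+ ℤ_[p] := ∑ j, α j • Pi.evalAddMonoidHom _ j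
  have hL (v : Fin 2 → ℤ_[p]) : L v = ∑ j, α j • v j := by simp [L]
  have hdvd (v : Fin 2 → ℤ_[p]) : (p : ℤ_[p]) ^ (c + 2) ∣ L v - (y 0 * v 1 - y 1 * v 0) := by
    have h := dvd_sub ((hl 1).mul_right (v 0)) ((hl 0).mul_right (v 1))
    convert h using 1
    simp only [hL, hα, zsmul_eq_mul, Fin.sum_univ_two, Matrix.cons_val_zero, Int.cast_neg,
      Int.cast_natCast, neg_mul, Matrix.cons_val_one]
    ring
  have hLy : (p : ℤ_[p]) ^ (c + 2) ∣ L y := by simpa [mul_comm] using hdvd y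
  have hLE : (p : ℤ_[p]) ^ (c + 1) ∣ L (E • y) - (p : ℤ_[p]) ^ c * η := by
    rw [mul_comm, ← hη]
    exact (pow_dvd_pow _ (Nat.le_succ _)).trans (hdvd _)
  refine ⟨α, fun h0 => ?_, fun i => ?_⟩
  · rw [hL, h0] at hLE
    simp only [Pi.zero_apply, zero_smul, Finset.sum_const_zero, zero_sub, dvd_neg, pow_succ] at hLE
    rw [mul_dvd_mul_iff_left (pow_ne_zero _ PadicInt.prime_p.ne_zero)] at hLE
    exact PadicInt.prime_p.not_isUnit (isUnit_of_dvd_unit hLE η.isUnit)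
  · simpa only [hL] using exists_pow_dvd_map_one_add_sq_mul_pow_smul L η.isUnit hLy hLE i

theorem dist_le_pow_iff_dvd_sub {x y : ℤ_[p]} {k : ℕ} :
    dist x y ≤ (p : ℝ)⁻¹ ^ k ↔ (p : ℤ_[p]) ^ k ∣ x - y := by
  rw [dist_eq_norm, ← Ideal.mem_span_singleton, ← PadicInt.norm_le_pow_iff_mem_span_pow, zpow_neg,
    zpow_natCast, inv_pow]

theorem exists_inv_pow_lt (p : ℕ) [Fact p.Prime] {ε : ℝ} (hε : 0 < ε) : ∃ k, (p : ℝ)⁻¹ ^ k < ε :=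
  exists_pow_lt_of_lt_one hε (inv_lt_one_of_one_lt₀ (by exact_mod_cast (Fact.out : p.Prime).one_lt))

/-- A zero of an integral form on the orbit closure is obtained by compactness. -/
theorem exists_mem_closure_not_linearIndependent {y : Fin 2 → ℤ_[p]}
    {E : Matrix (Fin 2) (Fin 2) ℤ} (hy : y 0 * (E • y) 1 ≠ y 1 * (E • y) 0) :
    ∃ v ∈ closure (Set.range fun n : ℕ =>
      (1 + (p : Matrix (Fin 2) (Fin 2) ℤ) ^ 2 * E) ^ n • y), ¬ LinearIndependent ℤ v := by
  obtain ⟨α, hα, hdvd⟩ := exists_forall_pow_dvd_of_not_eigenvector hy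
  set O := Set.range fun n : ℕ => (1 + (p : Matrix (Fin 2) (Fin 2) ℤ) ^ 2 * E) ^ n • y
  have hcont : Continuous fun v : Fin 2 → ℤ_[p] => ∑ j, α j • v j := by fun_prop
  have hclosed : IsClosed ((fun v : Fin 2 → ℤ_[p] => ∑ j, α j • v j) '' closure O) :=
    (isClosed_closure.isCompact.image hcont).isClosed
  obtain ⟨v, hv, hv0⟩ : (0 : ℤ_[p]) ∈ (fun v : Fin 2 → ℤ_[p] => ∑ j, α j • v j) '' closure O := by
    refine hclosed.closure_subset_iff.2 (Set.image_mono subset_closure)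
      (Metric.mem_closure_iff.2 fun ε hε => ?_)
    obtain ⟨k, hk⟩ := exists_inv_pow_lt p hε
    obtain ⟨n, hn⟩ := hdvd k
    refine ⟨_, ⟨_, ⟨n, rfl⟩, rfl⟩, lt_of_le_of_lt ?_ hk⟩
    rw [dist_comm, dist_le_pow_iff_dvd_sub, sub_zero]
    exact hn
  exact ⟨v, hv, fun h => hα (funext (Fintype.linearIndependent_iff.1 h α hv0))⟩

end

section
variable {R ι M : Type*} [Ring R] [Fintype ι] [DecidableEq ι] [AddCommGroup M] [Module R M]

theorem matrix_smul_left_injective {z : ι → M} (hz : LinearIndependent R z) :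
    Function.Injective fun A : Matrix ι ι R => A • z := fun A B hAB =>
  Matrix.ext fun i => Fintype.linearIndependent_iffₛ.1 hz (A i) (B i) (congrFun hAB i)

instance {S : Type*} [DistribSMul S M] [SMulCommClass S R M] :
    SMulCommClass S (Matrix ι ι R) (ι → M) where
  smul_comm c A v := by
    ext i
    simp only [Pi.smul_apply, Matrix.Module.smul_apply, Finset.smul_sum, smul_comm c]

instance [TopologicalSpace M] [ContinuousAdd M] [ContinuousConstSMul R M] :
    ContinuousConstSMul (Matrix ι ι R) (ι → M) where
  continuous_const_smul A := by
    simp only [Matrix.Module.smul_def]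
    fun_prop

end

theorem commute_of_common_eigenvector {R : Type*} [CommRing R] [IsDomain R] {z : Fin 2 → R}
    (hz : LinearIndependent ℤ z) {A B : Matrix (Fin 2) (Fin 2) ℤ}
    (hA : z 0 * (A • z) 1 = z 1 * (A • z) 0) (hB : z 0 * (B • z) 1 = z 1 * (B • z) 0) :
    Commute A B := by
  have heig {A : Matrix (Fin 2) (Fin 2) ℤ} (hA : z 0 * (A • z) 1 = z 1 * (A • z) 0) :
      z 0 • A • z = (A • z) 0 • z := by
    ext i
    fin_cases i
    · exact mul_comm _ _
    · exact hA.trans (mul_comm _ _)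
  have hprod {A B : Matrix (Fin 2) (Fin 2) ℤ} (hA : z 0 * (A • z) 1 = z 1 * (A • z) 0)
      (hB : z 0 * (B • z) 1 = z 1 * (B • z) 0) :
      z 0 • z 0 • (A * B) • z = ((A • z) 0 * (B • z) 0) • z := by
    rw [mul_smul, smul_comm (z 0) A, heig hB, ← smul_comm _ A, smul_comm (z 0) _ (A • z),
      heig hA, smul_smul, mul_comm]
  refine matrix_smul_left_injective hz (smul_right_injective _ (hz.ne_zero 0)
    (smul_right_injective _ (hz.ne_zero 0) ?_))
  simp only
  rw [hprod hA hB, hprod hB hA, mul_comm]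

theorem exists_forall_smul_mem_of_approx {G X : Type*} [PseudoMetricSpace X] [CompactSpace X]
    [SMul G X] [ContinuousConstSMul G X] {C : Set X} (hC : IsClosed C) (H : Set G)
    (h : ∀ ε > (0 : ℝ), ∃ x, ∀ g ∈ H, ∃ v ∈ C, dist v (g • x) < ε) :
    ∃ z : X, ∀ g ∈ H, g • z ∈ C := by
  choose x hx using fun k : ℕ => h (1 / (k + 1)) Nat.one_div_pos_of_nat
  obtain ⟨z, -, ψ, hψ, hz⟩ := isCompact_univ.tendsto_subseq
    (x := x) fun _ => Set.mem_univ _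
  refine ⟨z, fun g hg => ?_⟩
  choose v hvC hv using fun k => hx (ψ k) g hg
  refine hC.mem_of_tendsto (((continuous_const_smul g).tendsto z |>.comp hz).congr_dist ?_)
    (.of_forall hvC)
  refine squeeze_zero (fun _ => dist_nonneg) (fun k => ?_)
    (tendsto_one_div_add_atTop_nhds_zero_nat.comp hψ.tendsto_atTop)
  rw [dist_comm]
  exact (hv k).le

theorem exists_pow_eq_one_add_natCast_mul {n : Type*} [Fintype n] [DecidableEq n] (m : ℕ)
    [NeZero m] :
    ∃ k ≠ 0, ∀ g : GL n ℤ, ∃ E : Matrix n n ℤ, (g ^ k).1 = 1 + (m : Matrix n n ℤ) * E := by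
  have : Finite (Matrix n n (ZMod m)) := inferInstanceAs (Finite (n → n → ZMod m))
  refine ⟨Nat.card (GL n (ZMod m)), Nat.card_pos.ne', fun g => ?_⟩
  set h := g ^ Nat.card (GL n (ZMod m)) with hh
  have hone : Matrix.GeneralLinearGroup.map (Int.castRingHom (ZMod m)) h = 1 := by
    rw [hh, map_pow, pow_card_eq_one']
  have hdvd (i j : n) : (m : ℤ) ∣ h.1 i j - (1 : Matrix n n ℤ) i j := by
    have hij : (h.1 i j : ZMod m) = (1 : Matrix n n (ZMod m)) i j :=
      congrArg (fun x : GL n (ZMod m) => x.1 i j) hone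
    rw [← ZMod.intCast_zmod_eq_zero_iff_dvd, Int.cast_sub, hij, Matrix.one_apply, Matrix.one_apply,
      Int.cast_ite, Int.cast_one, Int.cast_zero, sub_self]
  choose E hE using hdvd
  refine ⟨Matrix.of E, ?_⟩
  ext i j
  rw [Matrix.add_apply, ← nsmul_eq_mul, Matrix.smul_apply, Matrix.of_apply, nsmul_eq_mul, ← hE,
    add_sub_cancel]

theorem exists_pow_forall_mem_closure_not_linearIndependent (p : ℕ) [Fact p.Prime] :
    ∃ k ≠ 0, ∀ (g : GL (Fin 2) ℤ) (y : Fin 2 → ℤ_[p]),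
      y 0 * (g ^ k • y) 1 ≠ y 1 * (g ^ k • y) 0 →
        ∃ v ∈ closure (Set.range fun n : ℕ => (g ^ k) ^ n • y), ¬ LinearIndependent ℤ v := by
  have : NeZero (p ^ 2) := ⟨pow_ne_zero _ (Fact.out : p.Prime).ne_zero⟩
  obtain ⟨k, hk, hE⟩ := exists_pow_eq_one_add_natCast_mul (n := Fin 2) (p ^ 2)
  refine ⟨k, hk, fun g y hy => ?_⟩
  obtain ⟨E, hE⟩ := hE g
  rw [Nat.cast_pow] at hE
  have hgE : g ^ k • y = y + (p : ℤ_[p]) ^ 2 • E • y := by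
    rw [Units.smul_def, hE, add_smul, one_smul, mul_smul, ← Nat.cast_pow, Nat.cast_smul_eq_nsmul,
      ← Nat.cast_pow, Nat.cast_smul_eq_nsmul]
  have hEy : y 0 * (E • y) 1 ≠ y 1 * (E • y) 0 := by
    intro h
    refine hy ?_
    rw [hgE, Pi.add_apply, Pi.add_apply, Pi.smul_apply, Pi.smul_apply, smul_eq_mul, smul_eq_mul]
    linear_combination (p : ℤ_[p]) ^ 2 * h
  simpa only [Units.smul_def, Units.val_pow_eq_pow_val (g ^ k), hE] using
    exists_mem_closure_not_linearIndependent hEy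

section
variable {p : ℕ} [Fact p.Prime]

theorem toZModPow_comp_matrix_smul {ι : Type*} [Fintype ι] [DecidableEq ι] (k : ℕ)
    (A : Matrix ι ι ℤ) (y : ι → ℤ_[p]) :
    PadicInt.toZModPow k ∘ (A • y) = A • (PadicInt.toZModPow k ∘ y) :=
  ((PadicInt.toZModPow k).toIntAlgHom.toLinearMap.mapMatrixModule ι).map_smul A y

theorem dist_le_of_toZModPow_eq {x y : ℤ_[p]} {k : ℕ}
    (h : PadicInt.toZModPow k x = PadicInt.toZModPow k y) : dist x y ≤ (p : ℝ)⁻¹ ^ k := by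
  rwa [dist_le_pow_iff_dvd_sub, ← Ideal.mem_span_singleton, ← PadicInt.ker_toZModPow,
    RingHom.sub_mem_ker_iff]

end

/-! ### Products of the matrices `A_c` -/

section
variable {p : ℕ} [Fact p.Prime]

theorem QuasiSturmian.exists_forall_smul_mem_closure {α ι : Type*} [Fintype ι] [DecidableEq ι]
    {w : ℕ → α} {n₀ : ℕ} {a b : α} (h : QuasiSturmian w n₀ a b) (γ : α → GL ι ℤ)
    (y : ι → ℤ_[p]) :
    ∃ z : ι → ℤ_[p], ∀ g ∈ loopGroup γ w n₀ a b,
      g • z ∈ closure (Set.range fun t => cocycle γ w t • y) := by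
  refine exists_forall_smul_mem_of_approx isClosed_closure
    (loopGroup γ w n₀ a b : Set (GL ι ℤ)) fun ε hε => ?_
  obtain ⟨k, hk⟩ := exists_inv_pow_lt p hε
  have : NeZero (p ^ k) := ⟨pow_ne_zero _ (Fact.out : p.Prime).ne_zero⟩
  obtain ⟨s, hs⟩ := h.exists_loopGroup_smul_subset γ (PadicInt.toZModPow k ∘ y)
  refine ⟨cocycle γ w s • y, fun g hg => ?_⟩
  obtain ⟨t, ht⟩ := hs g hg
  refine ⟨_, subset_closure ⟨t, rfl⟩, lt_of_le_of_lt ?_ hk⟩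
  simp only [Units.smul_def, ← toZModPow_comp_matrix_smul] at ht ⊢
  exact (dist_pi_le_iff (by positivity)).2 fun i => dist_le_of_toZModPow_eq (congrFun ht i)

end

/-- The matrix `A_a` as an element of `GL₂(ℤ)`. -/
def letterUnit (a : ℕ) : GL (Fin 2) ℤ where
  val := !![0, 1; 1, (a : ℤ)]
  inv := !![-(a : ℤ), 1; 1, 0]
  val_inv := by ext i j; fin_cases i <;> fin_cases j <;> simp
  inv_val := by ext i j; fin_cases i <;> fin_cases j <;> simp

/-- The bottom row of `M` is positive and increasing. The bottom row of `M * A_c` determines `c`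
for such `M`. -/
def BottomRowIncreases (M : GL (Fin 2) ℤ) : Prop :=
  0 < M.1 1 0 ∧ M.1 1 0 ≤ M.1 1 1

theorem mul_letterUnit_apply_zero (M : GL (Fin 2) ℤ) (c : ℕ) (i : Fin 2) :
    (M * letterUnit c).1 i 0 = M.1 i 1 := by
  simp [letterUnit, Matrix.mul_apply, Fin.sum_univ_two]

theorem mul_letterUnit_apply_one (M : GL (Fin 2) ℤ) (c : ℕ) (i : Fin 2) :
    (M * letterUnit c).1 i 1 = M.1 i 0 + c * M.1 i 1 := by
  simp [letterUnit, Matrix.mul_apply, Fin.sum_univ_two, mul_comm]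

/-- The submonoid generated by the matrices `A_c` with `c ≥ 1`. -/
def letterMonoid : Submonoid (GL (Fin 2) ℤ) :=
  Submonoid.closure (letterUnit '' Set.Ici 1)

theorem letterUnit_mem_letterMonoid {c : ℕ} (hc : 1 ≤ c) : letterUnit c ∈ letterMonoid :=
  Submonoid.subset_closure ⟨c, hc, rfl⟩

theorem bottomRowIncreases_letterUnit {c : ℕ} (hc : 1 ≤ c) :
    BottomRowIncreases (letterUnit c) := by
  simpa [BottomRowIncreases, letterUnit] using hc

namespace BottomRowIncreases
variable {M M' x y : GL (Fin 2) ℤ} {a b c : ℕ}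

theorem mul_letterUnit (hM : BottomRowIncreases M) (hc : 1 ≤ c) :
    BottomRowIncreases (M * letterUnit c) := by
  obtain ⟨h0, h1⟩ := hM
  have : (1 : ℤ) ≤ c := by exact_mod_cast hc
  rw [BottomRowIncreases, mul_letterUnit_apply_zero, mul_letterUnit_apply_one]
  exact ⟨h0.trans_le h1, by nlinarith⟩

theorem mul_of_mem (hM : BottomRowIncreases M) (hx : x ∈ letterMonoid) :
    BottomRowIncreases (M * x) := by
  induction hx using Submonoid.closure_induction_right with
  | one => rwa [mul_one]
  | mul_right x _ _ hc ih =>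
    obtain ⟨c, hc, rfl⟩ := hc
    rw [← mul_assoc]
    exact ih.mul_letterUnit hc

theorem of_mem_mul_letterUnit (hx : x ∈ letterMonoid) (hc : 1 ≤ c) :
    BottomRowIncreases (x * letterUnit c) := by
  induction hx using Submonoid.closure_induction_right generalizing c with
  | one => exact (one_mul (letterUnit c)).symm ▸ bottomRowIncreases_letterUnit hc
  | mul_right x _ _ hd ih =>
    obtain ⟨d, hd, rfl⟩ := hd
    exact (ih hd).mul_letterUnit hc

theorem letter_eq (hM : BottomRowIncreases M) (hM' : BottomRowIncreases M')
    (h : M * letterUnit a = M' * letterUnit b) : a = b := by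
  have h0 : M.1 1 1 = M'.1 1 1 := by
    rw [← mul_letterUnit_apply_zero M a, h, mul_letterUnit_apply_zero]
  have h1 : M.1 1 0 + a * M.1 1 1 = M'.1 1 0 + b * M.1 1 1 := by
    rw [← mul_letterUnit_apply_one, h, mul_letterUnit_apply_one, h0]
  obtain ⟨hM0, hM1⟩ := hM
  obtain ⟨hM'0, hM'1⟩ := hM'
  rw [← h0] at hM'1
  rcases lt_trichotomy a b with hab | hab | hab
  · have : (a : ℤ) + 1 ≤ b := by exact_mod_cast hab
    nlinarith
  · exact hab
  · have : (b : ℤ) + 1 ≤ a := by exact_mod_cast hab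
    nlinarith

end BottomRowIncreases

theorem letter_eq_of_commute_pow {x y : GL (Fin 2) ℤ} {a b k : ℕ} (hx : x ∈ letterMonoid)
    (hy : y ∈ letterMonoid) (ha : 1 ≤ a) (hb : 1 ≤ b) (hk : k ≠ 0)
    (h : Commute ((x * letterUnit a) ^ k) ((y * letterUnit b) ^ k)) : a = b := by
  obtain ⟨k, rfl⟩ := Nat.exists_eq_succ_of_ne_zero hk
  have hrow {x y : GL (Fin 2) ℤ} {a b : ℕ} (hx : x ∈ letterMonoid) (hy : y ∈ letterMonoid)
      (ha : 1 ≤ a) (hb : 1 ≤ b) : BottomRowIncreases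
        ((x * letterUnit a) ^ (k + 1) * ((y * letterUnit b) ^ k * y)) := by
    have hpow {x : GL (Fin 2) ℤ} {a : ℕ} (hx : x ∈ letterMonoid) (ha : 1 ≤ a) :
        (x * letterUnit a) ^ k * x ∈ letterMonoid :=
      mul_mem (pow_mem (mul_mem hx (letterUnit_mem_letterMonoid ha)) k) hx
    rw [pow_succ (x * letterUnit a), ← mul_assoc (_ ^ k) x]
    exact (BottomRowIncreases.of_mem_mul_letterUnit (hpow hx ha) ha).mul_of_mem (hpow hy hb)
  refine (BottomRowIncreases.letter_eq (hrow hx hy ha hb) (hrow hy hx hb ha) ?_).symm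
  simpa only [pow_succ, mul_assoc] using h.eq

/-- Otherwise the orbit closure of some `z` under the loop group consists of independent vectors,
so that `z` is an eigenvector of `gᵏ` for every element `g` of the group; the powers of the two
loop products would then commute. -/
theorem QuasiSturmian.exists_mem_closure_not_linearIndependent {p : ℕ} [Fact p.Prime] {w : ℕ → ℕ}
    {n₀ a b : ℕ} (h : QuasiSturmian w n₀ a b) (hw : ∀ i, 1 ≤ w i) (y : Fin 2 → ℤ_[p]) :
    ∃ v ∈ closure (Set.range fun t => cocycle letterUnit w t • y), ¬ LinearIndependent ℤ v := by
  by_contra! hind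
  obtain ⟨z, hz⟩ := h.exists_forall_smul_mem_closure letterUnit y
  obtain ⟨k, hk, hpow⟩ := exists_pow_forall_mem_closure_not_linearIndependent p
  have heig (g : GL (Fin 2) ℤ) (hg : g ∈ loopGroup letterUnit w n₀ a b) :
      z 0 * (g ^ k • z) 1 = z 1 * (g ^ k • z) 0 := by
    by_contra hne
    obtain ⟨v, hv, hvind⟩ := hpow g z hne
    refine hvind (hind v (closure_minimal ?_ isClosed_closure hv))
    rintro _ ⟨n, rfl⟩
    exact hz _ (pow_mem (pow_mem hg k) n)
  have hzind : LinearIndependent ℤ z := hind z (by simpa using hz 1 (one_mem _))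
  have hcomm := commute_of_common_eigenvector hzind
    (heig (loopValue letterUnit w n₀ a) (Subgroup.subset_closure (by simp)))
    (heig (loopValue letterUnit w n₀ b) (Subgroup.subset_closure (by simp)))
  have hle : Submonoid.closure (Set.range (letterUnit ∘ w)) ≤ letterMonoid :=
    Submonoid.closure_mono (by rintro _ ⟨i, rfl⟩; exact ⟨w i, hw i, rfl⟩)
  obtain ⟨x, hx, hxa⟩ := h.exists_loopValue_eq_mul letterUnit le_rfl
  obtain ⟨x', hx', hxb⟩ := h.symm.exists_loopValue_eq_mul letterUnit le_rfl
  rw [hxa, hxb] at hcomm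
  have ha : 1 ≤ a := by
    obtain ⟨t, -, -, rfl⟩ := h.exists_mem_special_eq_left le_rfl 0
    exact hw t
  have hb : 1 ≤ b := by
    obtain ⟨t, -, -, rfl⟩ := h.symm.exists_mem_special_eq_left le_rfl 0
    exact hw t
  exact h.ne (letter_eq_of_commute_pow (hle hx) (hle hx') ha hb hk (Units.ext hcomm.eq))

/-! ### Orbits of the points of **LMad** -/

section
variable {p : ℕ} [Fact p.Prime] {ι : Type*} [Fintype ι]

theorem coe_matrix_smul [DecidableEq ι] (A : Matrix ι ι ℤ) (y : ι → ℤ_[p]) :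
    (fun i => ((A • y) i : ℚ_[p])) = A • fun i => (y i : ℚ_[p]) :=
  ((PadicInt.Coe.ringHom (p := p)).toIntAlgHom.toLinearMap.mapMatrixModule ι).map_smul A y

theorem norm_matrix_smul_le [DecidableEq ι] (A : Matrix ι ι ℤ) (y : ι → ℤ_[p]) :
    ‖A • y‖ ≤ ‖y‖ := by
  refine (pi_norm_le_iff_of_nonneg (norm_nonneg y)).2 fun i => ?_
  refine IsUltrametricDist.norm_sum_le_of_forall_le_of_nonneg (norm_nonneg y) fun j _ => ?_
  rw [zsmul_eq_mul, norm_mul]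
  exact (mul_le_of_le_one_left (norm_nonneg _) (PadicInt.norm_le_one _)).trans (norm_le_pi_norm y j)

theorem norm_unimodular_smul [DecidableEq ι] (g : GL ι ℤ) (y : ι → ℤ_[p]) : ‖g • y‖ = ‖y‖ := by
  refine le_antisymm (norm_matrix_smul_le _ y) ?_
  simpa only [← Units.smul_def, inv_smul_smul] using norm_matrix_smul_le (g⁻¹).1 (g • y)

theorem exists_smul_eq_coe {v : ι → ℚ_[p]} (hv : v ≠ 0) :
    ∃ c : ℚ_[p], c ≠ 0 ∧ ∃ y : ι → ℤ_[p], ‖y‖ = 1 ∧ c • v = fun i => (y i : ℚ_[p]) := by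
  obtain ⟨j, hj⟩ := Function.ne_iff.1 hv
  have : Nonempty ι := ⟨j⟩
  obtain ⟨i, hi⟩ := Finite.exists_max fun i => ‖v i‖
  have hvi : v i ≠ 0 := norm_pos_iff.1 ((norm_pos_iff.2 hj).trans_le (hi j))
  have hle (j : ι) : ‖(v i)⁻¹ * v j‖ ≤ 1 := by
    rw [norm_mul, norm_inv, inv_mul_le_iff₀ (norm_pos_iff.2 hvi), mul_one]
    exact hi j
  let y : ι → ℤ_[p] := fun j => ⟨(v i)⁻¹ * v j, hle j⟩
  have hyi : y i = 1 := PadicInt.ext (inv_mul_cancel₀ hvi)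
  refine ⟨(v i)⁻¹, inv_ne_zero hvi, y, le_antisymm ?_ ?_, rfl⟩
  · exact (pi_norm_le_iff_of_nonneg zero_le_one).2 fun j => PadicInt.norm_le_one _
  · simpa only [hyi, norm_one] using norm_le_pi_norm y i

end

section
variable {p : ℕ} [Fact p.Prime]

theorem PBadVec.linearIndependent {ε : ℝ} {q : Fin 2 → ℚ_[p]} (hε : 0 < ε)
    (h : PBadVec p ε q) : LinearIndependent ℤ q := by
  refine Fintype.linearIndependent_iff.2 fun a ha => funext_iff.1 ?_
  by_contra! hne
  have hmax : 0 < max ((a 0 : ℝ) ^ 2) ((a 1 : ℝ) ^ 2) := by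
    refine lt_max_iff.2 ?_
    contrapose! hne
    exact funext (Fin.forall_fin_two.2 (by simpa [sq_nonpos_iff] using hne))
  refine (div_pos hε hmax).not_ge ((h (a 0) (a 1) ?_).trans_eq ?_)
  · contrapose! hne
    exact funext (Fin.forall_fin_two.2 (by simpa using hne))
  · rw [Fin.sum_univ_two, zsmul_eq_mul, zsmul_eq_mul] at ha
    rw [ha, norm_zero, zero_div]

theorem PBadVec_coe_iff {ε : ℝ} {y : Fin 2 → ℤ_[p]} (hy : ‖y‖ = 1) :
    (PBadVec p ε fun i => y i) ↔ ∀ a b : ℤ, (a, b) ≠ (0, 0) →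
      ε / max ((a : ℝ) ^ 2) ((b : ℝ) ^ 2) ≤ ‖a • y 0 + b • y 1‖ := by
  have hmax : max ‖(y 0 : ℚ_[p])‖ ‖(y 1 : ℚ_[p])‖ = 1 := by
    rw [← PadicInt.norm_def, ← PadicInt.norm_def, ← hy]
    refine le_antisymm (max_le (norm_le_pi_norm y 0) (norm_le_pi_norm y 1)) ?_
    refine (pi_norm_le_iff_of_nonneg (by positivity)).2 (Fin.forall_fin_two.2 ?_)
    exact ⟨le_max_left _ _, le_max_right _ _⟩
  simp only [PBadVec, hmax, div_one, PadicInt.norm_def, zsmul_eq_mul,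
    PadicInt.coe_add, PadicInt.coe_mul, PadicInt.coe_intCast]

theorem isClosed_setOf_norm_eq_one_and_PBadVec (ε : ℝ) :
    IsClosed {y : Fin 2 → ℤ_[p] | ‖y‖ = 1 ∧ PBadVec p ε fun i => y i} := by
  have hset : {y : Fin 2 → ℤ_[p] | ‖y‖ = 1 ∧ PBadVec p ε fun i => y i} =
      {y | ‖y‖ = 1 ∧ ∀ a b : ℤ, (a, b) ≠ (0, 0) →
        ε / max ((a : ℝ) ^ 2) ((b : ℝ) ^ 2) ≤ ‖a • y 0 + b • y 1‖} :=
    Set.ext fun y => and_congr_right PBadVec_coe_iff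
  rw [hset]
  simp only [Set.ofPred_and, Set.ofPred_forall]
  refine (isClosed_eq continuous_norm continuous_const).inter ?_
  refine isClosed_iInter fun a => isClosed_iInter fun b => isClosed_iInter fun _ => ?_
  exact isClosed_le continuous_const (by fun_prop)

theorem letterAct_mk (a : ℕ) {v : Fin 2 → ℚ_[p]} (hv : v ≠ 0) :
    letterAct p a (.mk ℚ_[p] v hv) =
      .mk ℚ_[p] (letterUnit a • v) ((smul_ne_zero_iff_ne _).2 hv) := by
  rw [letterAct, Projectivization.map_mk]
  congr 1
  ext i
  fin_cases i <;>
    simp [letterMatrix, letterUnit, Units.smul_def, Matrix.Module.smul_apply, Matrix.vecHead,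
      Matrix.vecTail]

theorem shift_iterate (w : ℕ → ℕ) {v : Fin 2 → ℚ_[p]} (hv : v ≠ 0) (t : ℕ) :
    (shift p)^[t] (w, .mk ℚ_[p] v hv) =
      (tail w t, .mk ℚ_[p] (cocycle letterUnit w t • v) ((smul_ne_zero_iff_ne _).2 hv)) := by
  induction t with
  | zero =>
    simp only [Function.iterate_zero, id_eq, cocycle, one_smul]
    exact Prod.ext (funext fun k => congrArg w (zero_add k).symm) rfl
  | succ t ih =>
    rw [Function.iterate_succ_apply', ih, shift, letterAct_mk]
    simp only [cocycle, mul_smul]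
    exact Prod.ext (funext fun k => congrArg w (by omega)) rfl

theorem mem_LMad_tail {w : ℕ → ℕ} {x : P1 p} (h : (w, x) ∈ LMad p) (i : ℕ) :
    ∃ x' : P1 p, (tail w i, x') ∈ LMad p := by
  induction x using Projectivization.ind with
  | h v hv =>
    obtain ⟨ε, hε, hx⟩ := h
    refine ⟨.mk ℚ_[p] (cocycle letterUnit w i • v) ((smul_ne_zero_iff_ne _).2 hv), ε, hε,
      fun n => ?_⟩
    rw [← shift_iterate w hv i, ← Function.iterate_add_apply]
    exact hx (n + i)

theorem exists_forall_mem_closure_linearIndependent {w : ℕ → ℕ} {x : P1 p} (h : (w, x) ∈ LMad p) :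
    ∃ y : Fin 2 → ℤ_[p], ∀ v ∈ closure (Set.range fun t => cocycle letterUnit w t • y),
      LinearIndependent ℤ v := by
  induction x using Projectivization.ind with
  | h v hv =>
    obtain ⟨ε, hε, hx⟩ := h
    obtain ⟨c, hc, y, hy, hcy⟩ := exists_smul_eq_coe hv
    have horbit (t : ℕ) : PBadVec p ε fun i => ((cocycle letterUnit w t • y) i : ℚ_[p]) := by
      have ht := (hx t).2
      rw [shift_iterate, mk_mem_PBad, ← PBadVec_smul p ε c hc] at ht
      rwa [Units.smul_def, coe_matrix_smul, ← hcy, ← smul_comm]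
    refine ⟨y, fun u hu => ?_⟩
    have hubad := (closure_minimal (by
      rintro _ ⟨t, rfl⟩
      exact ⟨(norm_unimodular_smul _ y).trans hy, horbit t⟩)
      (isClosed_setOf_norm_eq_one_and_PBadVec ε) hu).2
    exact (hubad.linearIndependent hε).of_comp
      (PadicInt.Coe.ringHom (p := p)).toIntAlgHom.toLinearMap

theorem notMem_LMad_of_complexity_le {N B : ℕ} {w : ℕ → ℕ} (hw : InAlphabet N w)
    (hper : ¬ EventuallyPeriodic w) (hB : ∀ n, complexity w n ≤ n + B) (x : P1 p) :
    (w, x) ∉ LMad p := by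
  intro hx
  have hfin : (Set.range w).Finite :=
    (Set.finite_Icc 1 N).subset (Set.range_subset_iff.2 hw)
  obtain ⟨i, n₀, a, b, hqs⟩ := exists_quasiSturmian_tail hfin hper hB
  obtain ⟨x', hx'⟩ := mem_LMad_tail hx i
  obtain ⟨y, hy⟩ := exists_forall_mem_closure_linearIndependent hx'
  obtain ⟨v, hv, hvdep⟩ :=
    hqs.exists_mem_closure_not_linearIndependent (fun k => (hw (i + k)).1) y
  exact hvdep (hy v hv)

end

end LimitMad

theorem theorem2p3 (p : ℕ) [Fact p.Prime] (N : ℕ) (w : ℕ → ℕ) (hw : LimitMad.InAlphabet N w) :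
    (¬ LimitMad.EventuallyPeriodic w →
      (∃ C : ℝ, 0 < C ∧ ∀ n : ℕ, 1 ≤ n → (LimitMad.complexity w n : ℝ) ≤ n + C) →
        ∀ x : LimitMad.P1 p, (w, x) ∉ LimitMad.LMad p) ∧
    (LimitMad.IsSturmian w → ∀ x : LimitMad.P1 p, (w, x) ∉ LimitMad.LMad p) := by
  constructor
  · rintro hper ⟨C, hC, h⟩ x
    refine LimitMad.notMem_LMad_of_complexity_le hw hper (B := ⌈C⌉₊) (fun n => ?_) x
    rcases Nat.eq_zero_or_pos n with rfl | hn
    · rw [LimitMad.complexity_zero, zero_add]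
      exact Nat.ceil_pos.2 hC
    · exact_mod_cast (h n hn).trans (add_le_add le_rfl (Nat.le_ceil C))
  · intro hst x
    refine LimitMad.notMem_LMad_of_complexity_le hw (fun hper => ?_) (B := 1)
      (fun n => (hst n).le) x
    obtain ⟨B, hB⟩ := hper.exists_complexity_le
    have hBB := hB B
    rw [hst B] at hBB
    omega
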